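/- **Setting.** Let $d\ge 2$, and let $\lambda:\mathbb{N}\to[0,\infty)$ satisfy $\lambda(k)>\lambda(0)=0$ for $k>0$, $\lambda(k')-\lambda(k)\le c(k'-k)$ for all $k\le k'$ and some finite $c$, and $\lambda(k)\to\infty$. Put $Z(\varphi)=\sum_{k\ge0}\varphi^k/\prod_{1\le l\le k}\lambda(l)$. For $\rho\ge0$ let $\nu_\rho$ be the product measure on $X=\mathbb{N}^{\mathbb{Z}^d}$ with $$\nu_\rho(\eta(x)=k)=\frac{\varphi(\rho)^k}{Z(\varphi(\rho))\prod_{1\le l\le k}\lambda(l)},$$ where $\varphi(\rho)\ge0$ is chosen so that $\mathbb{E}_{\nu_\rho}[\eta(0)]=\rho$. Let $w:[0,\infty)\to[0,\infty)$ be convex with $w(x)/x\to\infty$ as $x\to\infty$ and such that for every $\rho\ge0$ there is $\theta>0$ with $\mathbb{E}_{\nu_\rho}[e^{\theta w(\eta(0))}]<\infty$. Write $|\cdot|$ for the supremum norm on $\mathbb{Z}^d$, and set $\bar\eta^{\ell}(x)=(2\ell+1)^{-d}\sum_{|y-x|\le \ell}\eta(y)$ for $\ell\in\mathbb{N}$ and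 $\bar\eta^{N\epsilon}=\bar\eta^{\lfloor N\epsilon\rfloor}$. For a probability density $f$ with respect to $\nu_\rho$ let $$\mathfrak{d}(f)=\sum_{x\sim y}\int_X\lambda(\eta(x))\Big[\sqrt{f(\eta+1_y-1_x)}-\sqrt{f(\eta)}\Big]^2\nu_\rho(d\eta)\in[0,\infty],$$ the sum being over ordered pairs of nearest neighbours of $\mathbb{Z}^d$. Below, $\sup_f$ runs over all probability densities with respect to $\nu_\rho$, expectations take values in $[-\infty,\infty]$, and $\limsup_{\ell,\epsilon,N}$ means $\limsup_{\ell\to\infty}\limsup_{\epsilon\downarrow0}\limsup_{N\to\infty}$. **Proposition.** Fix $\rho>0$. There is $\beta_0>0$, depending on $d,\lambda,w,\rho$ but not on $\delta$, such that for all $0<\beta\le\beta_0$ and every $\delta>0$, however large, $$\limsup_{\ell,\epsilon,N}\ \sup_{x,y\in\mathbb{Z}^d:\,|x-y|\le N\epsilon}\ \sup_f\Big\{\mathbb{E}_{f\nu_\rho}\Big[|\bar\eta^\ell(x)-\bar\eta^\ell(y)|-\beta\big(w(\bar\eta^\ell(x))+w(\bar\eta^\ell(y))\big)\Big]-\delta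 N^{2-d}\mathfrak{d}(f)\Big\}>0.$$ If moreover $d\ge3$, then for the same $\beta$ and $\delta$ also $$\limsup_{\ell,\epsilon,N}\ \sup_{x\in\mathbb{Z}^d}\ \sup_f\Big\{\mathbb{E}_{f\nu_\rho}\Big[\frac1{(2\epsilon N+1)^d}\sum_{\ell<|y|\le\epsilon N}\Big(|\bar\eta^{N\epsilon}(x)-\bar\eta^\ell(x+y)|-\beta\big(w(\bar\eta^\ell(x))+w(\bar\eta^\ell(x+y))\big)\Big)\Big]-\delta N^{2-d}\mathfrak{d}(f)\Big\}>0.$$ -/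

import Mathlib

open MeasureTheory Filter Topology
open scoped ENNReal

noncomputable section

namespace ZeroRange

/-- Lattice sites `ℤ^d`; the norm that this type carries is the supremum norm `|·|_∞`. -/
abbrev Site (d : ℕ) : Type := Fin d → ℤ

/-- Particle configurations `X = ℕ^(ℤ^d)`, with the product σ-algebra. -/
abbrev Config (d : ℕ) : Type := Site d → ℕ

/-- Hypotheses on the local jump rate: `lam k > lam 0 = 0` for `k > 0`, the one-sided Lipschitz
bound, and `lam k → ∞`. -/
structure IsJumpRate (lam : ℕ → ℝ) : Prop where
  zero : lam 0 = 0
  pos : ∀ k, 0 < k → 0 < lam k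
  lipschitz : ∃ c : ℝ, ∀ k k' : ℕ, k ≤ k' → lam k' - lam k ≤ c * ((k' : ℝ) - (k : ℝ))
  tendsto : Tendsto lam atTop atTop

/-- The term `φ^k / ∏_{1 ≤ l ≤ k} lam l` of the partition function. -/
def weight (lam : ℕ → ℝ) (phi : ℝ) (k : ℕ) : ℝ :=
  phi ^ k / ∏ l ∈ Finset.Icc 1 k, lam l

/-- The partition function `Z(φ)`. -/
def partitionFn (lam : ℕ → ℝ) (phi : ℝ) : ℝ := ∑' k, weight lam phi k

/-- The probability of `k` particles at a site, at fugacity `φ`. -/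
def siteProb (lam : ℕ → ℝ) (phi : ℝ) (k : ℕ) : ℝ :=
  weight lam phi k / partitionFn lam phi

/-- The law on `ℕ` of the number of particles at a site, at fugacity `φ`. -/
def siteMeasure (lam : ℕ → ℝ) (phi : ℝ) : Measure ℕ :=
  Measure.sum fun k => ENNReal.ofReal (siteProb lam phi k) • Measure.dirac k

open Classical in
/-- The fugacity `φ(ρ) ≥ 0` for which the mean number of particles at a site is `ρ`. -/
def fugacity (lam : ℕ → ℝ) (rho : ℝ) : ℝ :=
  if h : ∃ phi : ℝ, 0 ≤ phi ∧ HasSum (fun k : ℕ => (k : ℝ) * siteProb lam phi k) rho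
  then h.choose else 0

/-- The equilibrium measure `ν_ρ`: the product over `ℤ^d` of the one-site laws of density `ρ`. -/
def equilibrium (lam : ℕ → ℝ) (d : ℕ) (rho : ℝ) : Measure (Config d) :=
  Measure.infinitePi fun _ : Site d => siteMeasure lam (fugacity lam rho)

/-- The convex superlinear functions on `[0, ∞)` with some exponential moment under every
equilibrium measure. -/
structure IsSuperlinearWeight (lam : ℕ → ℝ) (d : ℕ) (w : ℝ → ℝ) : Prop where
  nonneg : ∀ x, 0 ≤ x → 0 ≤ w x
  convex : ConvexOn ℝ (Set.Ici 0) w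
  superlinear : Tendsto (fun x => w x / x) atTop atTop
  exp_integrable : ∀ rho : ℝ, 0 ≤ rho → ∃ theta : ℝ, 0 < theta ∧
    Integrable (fun eta : Config d => Real.exp (theta * w (eta 0 : ℝ))) (equilibrium lam d rho)

/-- The discrete box `{y : |y - x|_∞ ≤ n}`. -/
def box {d : ℕ} (n : ℕ) (x : Site d) : Finset (Site d) :=
  Finset.Icc (x - fun _ => (n : ℤ)) (x + fun _ => (n : ℤ))

/-- The block average of `η` over the box of radius `n` about `x`. -/
def blockAvg {d : ℕ} (n : ℕ) (eta : Config d) (x : Site d) : ℝ :=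
  (∑ y ∈ box n x, (eta y : ℝ)) / (2 * (n : ℝ) + 1) ^ d

/-- Nearest neighbours in `ℤ^d`. -/
def Adj {d : ℕ} (x y : Site d) : Prop := ∑ i, |x i - y i| = 1

/-- The configuration `η + 1_y - 1_x`. It is only used with the factor `lam (η x)`, which
vanishes when there is no particle at `x`. -/
def move {d : ℕ} (eta : Config d) (x y : Site d) : Config d :=
  eta + Pi.single y 1 - Pi.single x 1

/-- Probability densities with respect to `ν`. -/
def densities {d : ℕ} (ν : Measure (Config d)) : Set (Config d → ℝ) :=
  {f | Measurable f ∧ (∀ eta, 0 ≤ f eta) ∧ ∫⁻ eta, ENNReal.ofReal (f eta) ∂ν = 1}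

/-- The contribution of the bond `(x, y)` to the Dirichlet form. -/
def bondDirichlet (lam : ℕ → ℝ) {d : ℕ} (ν : Measure (Config d)) (f : Config d → ℝ)
    (x y : Site d) : ℝ≥0∞ :=
  ∫⁻ eta, ENNReal.ofReal
    (lam (eta x) * (Real.sqrt (f (move eta x y)) - Real.sqrt (f eta)) ^ 2) ∂ν

/-- The Dirichlet form, the sum over all ordered pairs of nearest neighbours; it may be `∞`. -/
def dirichlet (lam : ℕ → ℝ) {d : ℕ} (ν : Measure (Config d)) (f : Config d → ℝ) : ℝ≥0∞ :=
  ∑' p : {p : Site d × Site d // Adj p.1 p.2}, bondDirichlet lam ν f p.1.1 p.1.2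

/-- The expectation of `F` under the probability measure `f ν`, with values in `[-∞, ∞]`: the
integral of the positive part minus the integral of the negative part (and `-∞` should both be
infinite). -/
def expect {d : ℕ} (ν : Measure (Config d)) (f F : Config d → ℝ) : EReal :=
  ((∫⁻ eta, ENNReal.ofReal (F eta) ∂(ν.withDensity fun eta => ENNReal.ofReal (f eta)) : ℝ≥0∞)
      : EReal)
    - ((∫⁻ eta, ENNReal.ofReal (-F eta) ∂(ν.withDensity fun eta => ENNReal.ofReal (f eta)) : ℝ≥0∞)
      : EReal)

/-- The penalised functional `E_{fν}[F] - δ N^(2-d) 𝔡(f)`. -/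
def penalised (lam : ℕ → ℝ) {d : ℕ} (ν : Measure (Config d)) (delta : ℝ) (N : ℕ)
    (F f : Config d → ℝ) : EReal :=
  expect ν f F
    - ((ENNReal.ofReal (delta * (N : ℝ) ^ ((2 : ℤ) - (d : ℤ))) * dirichlet lam ν f : ℝ≥0∞) : EReal)

/-- The observable of the two-block estimate at the sites `x`, `y`. -/
def pairObservable (w : ℝ → ℝ) {d : ℕ} (beta : ℝ) (l : ℕ) (x y : Site d) (eta : Config d) : ℝ :=
  |blockAvg l eta x - blockAvg l eta y| - beta * (w (blockAvg l eta x) + w (blockAvg l eta y))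

/-- The observable of the averaged two-block estimate at the site `x`: the sum runs over
`l < |y|_∞ ≤ ε N`. -/
def avgObservable (w : ℝ → ℝ) {d : ℕ} (beta : ℝ) (l : ℕ) (eps : ℝ) (N : ℕ) (x : Site d)
    (eta : Config d) : ℝ :=
  (1 / (2 * eps * (N : ℝ) + 1) ^ d) *
    ∑ y ∈ box ⌊(N : ℝ) * eps⌋₊ (0 : Site d) \ box l (0 : Site d),
      (|blockAvg ⌊(N : ℝ) * eps⌋₊ eta x - blockAvg l eta (x + y)|
        - beta * (w (blockAvg l eta x) + w (blockAvg l eta (x + y))))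

/-- The variational quantity of the two-block estimate, before the limits. -/
def twoBlock (lam : ℕ → ℝ) (w : ℝ → ℝ) (d : ℕ) (rho beta delta : ℝ) (l : ℕ) (eps : ℝ) (N : ℕ) :
    EReal :=
  ⨆ (x : Site d) (y : Site d) (_ : ‖x - y‖ ≤ (N : ℝ) * eps),
    ⨆ f ∈ densities (equilibrium lam d rho),
      penalised lam (equilibrium lam d rho) delta N (pairObservable w beta l x y) f

/-- The variational quantity of the averaged two-block estimate, before the limits. -/
def avgTwoBlock (lam : ℕ → ℝ) (w : ℝ → ℝ) (d : ℕ) (rho beta delta : ℝ) (l : ℕ) (eps : ℝ) (N : ℕ) :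
    EReal :=
  ⨆ (x : Site d), ⨆ f ∈ densities (equilibrium lam d rho),
    penalised lam (equilibrium lam d rho) delta N (avgObservable w beta l eps N x) f

/-- `limsup_{l → ∞} limsup_{ε → 0} limsup_{N → ∞}`. -/
def tripleLimsup (Q : ℕ → ℝ → ℕ → EReal) : EReal :=
  limsup (fun l : ℕ => limsup (fun eps : ℝ => limsup (fun N : ℕ => Q l eps N) atTop) (𝓝[>] 0)) atTop

end ZeroRange

end

/-! The trial densities are products of one-site tilts: the law at `z` is reweighted by `ψ z ^ (2
k)`, that is, its fugacity is multiplied by `ψ z ^ 2`, for a profile `ψ` with values in `[0, 1]`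
that equals `1` far away. The site is empty where `ψ = 0` and in equilibrium where `ψ = 1`. The
square root of such a density gains a factor `ψ z` for each particle added at `z`, so by detailed
balance each bond contributes at most `φ (ψ y - ψ x) ^ 2` to the Dirichlet form, and the total cost
is at most `φ` times the Dirichlet energy of `ψ` (`dirichlet_profileDensity_le`).

For the pair estimate, `ψ` empties the box of radius `l` about the origin. Capacity makes this
cheap: for `d = 2` a logarithmic profile has arbitrarily small energy, and for `d ≥ 3` a fixed
finite energy is killed by `N ^ (2 - d)` (`exists_profile`). One block is then empty, while another,
at a bounded distance, has mean `rho`. For the averaged estimate, an empty box of radius about `N ε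
/ 4` costs of order `ε ^ (d - 2)` after scaling, which vanishes with `ε` only if `d ≥ 3`. The large
block keeps mean at least `rho / 2`, while a positive fraction of the small blocks is empty
(`le_integral_avgObservable_cutoff`).

Each tilted density is at most the inverse of the equilibrium probability of an empty site, so the
means of `w` are bounded by a constant `K` free of `ψ`. By convexity the same holds for block
averages. Hence the threshold for `beta` depends on `K` and `rho` only, and `delta` enters only
through the choice of `ψ` or the smallness of `ε`. -/

noncomputable section

namespace ZeroRange

/-! ### The one-site law: fugacity, detailed balance and moments. -/

section Site

variable {lam : ℕ → ℝ}

lemma IsJumpRate.prod_pos (hlam : IsJumpRate lam) (k : ℕ) : 0 < ∏ l ∈ Finset.Icc 1 k, lam l :=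
  Finset.prod_pos fun l hl => hlam.pos l (Finset.mem_Icc.1 hl).1

lemma IsJumpRate.nonneg (hlam : IsJumpRate lam) (k : ℕ) : 0 ≤ lam k := by
  rcases Nat.eq_zero_or_pos k with rfl | hk
  · exact hlam.zero.ge
  · exact (hlam.pos k hk).le

lemma weight_zero (lam : ℕ → ℝ) (phi : ℝ) : weight lam phi 0 = 1 := by simp [weight]

lemma IsJumpRate.weight_nonneg (hlam : IsJumpRate lam) {phi : ℝ} (hphi : 0 ≤ phi) (k : ℕ) :
    0 ≤ weight lam phi k :=
  div_nonneg (pow_nonneg hphi k) (hlam.prod_pos k).le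

lemma IsJumpRate.mul_weight_succ (hlam : IsJumpRate lam) (phi : ℝ) (k : ℕ) :
    lam (k + 1) * weight lam phi (k + 1) = phi * weight lam phi k := by
  have h1 := (hlam.prod_pos k).ne'
  have h2 := (hlam.pos (k + 1) k.succ_pos).ne'
  rw [weight, weight, Finset.prod_Icc_succ_top (by omega), pow_succ]
  field_simp

lemma IsJumpRate.summable_weight (hlam : IsJumpRate lam) (phi : ℝ) :
    Summable (weight lam phi) := by
  rcases eq_or_ne phi 0 with rfl | hphi
  · refine summable_of_ne_finset_zero (s := {0}) fun k hk => ?_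
    simp [weight, zero_pow (by simpa using hk : k ≠ 0)]
  have hne : ∀ k, weight lam phi k ≠ 0 := fun k =>
    div_ne_zero (pow_ne_zero k hphi) (hlam.prod_pos k).ne'
  refine summable_of_ratio_test_tendsto_lt_one zero_lt_one (Eventually.of_forall hne) ?_
  have h : ∀ k, ‖weight lam phi (k + 1)‖ / ‖weight lam phi k‖ = |phi| / lam (k + 1) := by
    intro k
    have hl := hlam.pos (k + 1) k.succ_pos
    rw [div_eq_div_iff (norm_ne_zero_iff.2 (hne k)) hl.ne', ← abs_of_pos hl, Real.norm_eq_abs,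
      ← abs_mul, mul_comm, hlam.mul_weight_succ, abs_mul, Real.norm_eq_abs]
  simp only [h]
  exact (hlam.tendsto.comp (tendsto_add_atTop_nat 1)).const_div_atTop _

/-- Since `k ≤ 2 ^ k`, first moments reduce to convergence of the partition function at twice the
fugacity. -/
lemma cast_mul_weight_le (hlam : IsJumpRate lam) {phi : ℝ} (hphi : 0 ≤ phi) (k : ℕ) :
    (k : ℝ) * weight lam phi k ≤ weight lam (2 * phi) k := by
  have hk : (k : ℝ) ≤ 2 ^ k := by exact_mod_cast (Nat.lt_two_pow_self).le
  rw [weight, weight, mul_pow, mul_div_assoc]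
  exact mul_le_mul_of_nonneg_right hk (hlam.weight_nonneg hphi k)

lemma IsJumpRate.summable_mul_weight (hlam : IsJumpRate lam) {phi : ℝ} (hphi : 0 ≤ phi) :
    Summable fun k : ℕ => (k : ℝ) * weight lam phi k :=
  Summable.of_nonneg_of_le (fun k => mul_nonneg k.cast_nonneg (hlam.weight_nonneg hphi k))
    (cast_mul_weight_le hlam hphi) (hlam.summable_weight _)

lemma IsJumpRate.partitionFn_pos (hlam : IsJumpRate lam) {phi : ℝ} (hphi : 0 ≤ phi) :
    0 < partitionFn lam phi :=
  (hlam.summable_weight phi).tsum_pos (hlam.weight_nonneg hphi) 0 (by simp [weight_zero])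

lemma IsJumpRate.siteProb_nonneg (hlam : IsJumpRate lam) {phi : ℝ} (hphi : 0 ≤ phi) (k : ℕ) :
    0 ≤ siteProb lam phi k :=
  div_nonneg (hlam.weight_nonneg hphi k) (hlam.partitionFn_pos hphi).le

lemma IsJumpRate.hasSum_siteProb (hlam : IsJumpRate lam) {phi : ℝ} (hphi : 0 ≤ phi) :
    HasSum (siteProb lam phi) 1 := by
  have h := (hlam.summable_weight phi).hasSum.div_const (partitionFn lam phi)
  rwa [← partitionFn, div_self (hlam.partitionFn_pos hphi).ne'] at h

/-- Every density is attained at some fugacity. -/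
lemma IsJumpRate.exists_fugacity (hlam : IsJumpRate lam) {rho : ℝ} (hrho : 0 < rho) :
    ∃ phi : ℝ, 0 ≤ phi ∧ HasSum (fun k : ℕ => (k : ℝ) * siteProb lam phi k) rho := by
  -- With the partition function cleared, a zero of `G` is a fugacity of density `rho`; it comes
  -- from the intermediate value theorem.
  let G : ℝ → ℝ := fun phi => ∑' k : ℕ, ((k : ℝ) - rho) * weight lam phi k
  have hsum : ∀ phi, 0 ≤ phi → Summable fun k : ℕ => ((k : ℝ) - rho) * weight lam phi k := by
    intro phi hphi
    simpa only [sub_mul] using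
      (hlam.summable_mul_weight hphi).sub ((hlam.summable_weight phi).mul_left rho)
  have hcont : ∀ R : ℝ, 0 ≤ R → ContinuousOn G (Set.Icc 0 R) := by
    intro R hR
    refine continuousOn_tsum (u := fun k : ℕ => (k : ℝ) * weight lam R k + rho * weight lam R k)
      (fun k => ?_)
      ((hlam.summable_mul_weight hR).add ((hlam.summable_weight R).mul_left rho)) ?_
    · unfold weight; fun_prop
    · intro k phi hphi
      have hw := hlam.weight_nonneg hphi.1 k
      have hle : weight lam phi k ≤ weight lam R k :=
        div_le_div_of_nonneg_right (pow_le_pow_left₀ hphi.1 hphi.2 k) (hlam.prod_pos k).le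
      rw [norm_mul, Real.norm_eq_abs, Real.norm_eq_abs, abs_of_nonneg hw, ← add_mul]
      refine mul_le_mul ?_ hle hw (by positivity)
      refine (abs_sub _ _).trans_eq ?_
      rw [abs_of_nonneg k.cast_nonneg, abs_of_pos hrho]
  have h0 : G 0 ≤ 0 := by
    have : G 0 = -rho := by
      refine (tsum_eq_single 0 fun k hk => ?_).trans ?_
      · simp [weight, zero_pow hk]
      · simp [weight_zero]
    linarith
  obtain ⟨K, hK⟩ := exists_nat_gt rho
  set S : ℝ := ∑ k ∈ Finset.range K, weight lam 1 k with hS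
  have hSnn : 0 ≤ S := Finset.sum_nonneg fun k _ => hlam.weight_nonneg zero_le_one k
  have hwK : 0 < weight lam 1 (K + 1) := by
    have := hlam.prod_pos (K + 1)
    unfold weight; positivity
  -- The terms below `K` are at least `-rho * R ^ K * S` in total. This `R` lets the term at `K +
  -- 1`, whose coefficient exceeds `1`, outweigh them.
  set R : ℝ := 1 + rho * S / weight lam 1 (K + 1) with hR
  have hR1 : 1 ≤ R := by
    have : 0 ≤ rho * S / weight lam 1 (K + 1) := by positivity
    linarith
  have hR0 : 0 ≤ R := by linarith
  have hGR : 0 ≤ G R := by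
    have hscale : ∀ k, weight lam R k = R ^ k * weight lam 1 k := fun k => by
      simp [weight]
      ring
    have hlow : ∑ k ∈ Finset.range (K + 2), ((k : ℝ) - rho) * weight lam R k ≤ G R := by
      refine (hsum R hR0).sum_le_tsum _ fun k hk => ?_
      have hk' : K + 2 ≤ k := by simpa using hk
      have : (K : ℝ) + 2 ≤ k := by exact_mod_cast hk'
      exact mul_nonneg (by linarith) (hlam.weight_nonneg hR0 k)
    refine le_trans ?_ hlow
    rw [Finset.sum_range_succ, Finset.sum_range_succ]
    have ha : -(rho * (R ^ K * S)) ≤ ∑ k ∈ Finset.range K, ((k : ℝ) - rho) * weight lam R k := by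
      rw [hS, Finset.mul_sum, Finset.mul_sum, ← Finset.sum_neg_distrib]
      refine Finset.sum_le_sum fun k hk => ?_
      have h1 : R ^ k ≤ R ^ K := pow_le_pow_right₀ hR1 (Finset.mem_range.1 hk).le
      have h2 := hlam.weight_nonneg zero_le_one k
      have h3 : R ^ k * weight lam 1 k ≤ R ^ K * weight lam 1 k :=
        mul_le_mul_of_nonneg_right h1 h2
      have h4 : 0 ≤ R ^ k * weight lam 1 k := mul_nonneg (by positivity) h2
      rw [hscale]
      have h5 : 0 ≤ (k : ℝ) * (R ^ k * weight lam 1 k) := mul_nonneg k.cast_nonneg h4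
      nlinarith [mul_le_mul_of_nonneg_left h3 hrho.le]
    have hb : 0 ≤ ((K : ℝ) - rho) * weight lam R K :=
      mul_nonneg (by linarith) (hlam.weight_nonneg hR0 K)
    have hc : rho * (R ^ K * S) ≤ (((K + 1 : ℕ) : ℝ) - rho) * weight lam R (K + 1) := by
      have h1 : rho * S ≤ R * weight lam 1 (K + 1) := by
        rw [hR, add_mul, div_mul_cancel₀ _ hwK.ne']
        linarith
      have h2 : R ^ K * (rho * S) ≤ R ^ K * (R * weight lam 1 (K + 1)) :=
        mul_le_mul_of_nonneg_left h1 (by positivity)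
      have h3 : 0 ≤ weight lam R (K + 1) := hlam.weight_nonneg hR0 _
      have h4 : weight lam R (K + 1) = R ^ K * (R * weight lam 1 (K + 1)) := by
        rw [hscale, pow_succ, mul_assoc]
      have h5 : weight lam R (K + 1) ≤ (((K + 1 : ℕ) : ℝ) - rho) * weight lam R (K + 1) := by
        push_cast
        nlinarith
      linarith
    linarith
  obtain ⟨phi, hphi, hG⟩ := intermediate_value_Icc hR0 (hcont R hR0) ⟨h0, hGR⟩
  refine ⟨phi, hphi.1, ?_⟩
  have hZ := hlam.partitionFn_pos hphi.1
  have h1 : HasSum (fun k : ℕ => ((k : ℝ) - rho) * weight lam phi k) 0 := by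
    have := (hsum phi hphi.1).hasSum
    rwa [show ∑' k : ℕ, ((k : ℝ) - rho) * weight lam phi k = 0 from hG] at this
  have h2 := (h1.add ((hlam.summable_weight phi).hasSum.mul_left rho)).div_const
    (partitionFn lam phi)
  rw [← partitionFn, zero_add, mul_div_assoc, div_self hZ.ne', mul_one] at h2
  refine h2.congr_fun fun k => ?_
  simp only [siteProb]
  ring

lemma IsJumpRate.fugacity_nonneg (hlam : IsJumpRate lam) {rho : ℝ} (hrho : 0 < rho) :
    0 ≤ fugacity lam rho := by
  rw [fugacity, dif_pos (hlam.exists_fugacity hrho)]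
  exact (hlam.exists_fugacity hrho).choose_spec.1

lemma IsJumpRate.hasSum_fugacity (hlam : IsJumpRate lam) {rho : ℝ} (hrho : 0 < rho) :
    HasSum (fun k : ℕ => (k : ℝ) * siteProb lam (fugacity lam rho) k) rho := by
  rw [fugacity, dif_pos (hlam.exists_fugacity hrho)]
  exact (hlam.exists_fugacity hrho).choose_spec.2

lemma lintegral_siteMeasure (lam : ℕ → ℝ) (phi : ℝ) (g : ℕ → ℝ≥0∞) :
    ∫⁻ k, g k ∂siteMeasure lam phi = ∑' k, ENNReal.ofReal (siteProb lam phi k) * g k := by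
  simp [siteMeasure, lintegral_sum_measure]

lemma IsJumpRate.isProbabilityMeasure (hlam : IsJumpRate lam) {phi : ℝ} (hphi : 0 ≤ phi) :
    IsProbabilityMeasure (siteMeasure lam phi) := by
  refine ⟨?_⟩
  rw [← lintegral_one, lintegral_siteMeasure]
  simp only [mul_one]
  rw [← ENNReal.ofReal_tsum_of_nonneg (hlam.siteProb_nonneg hphi)
    (hlam.hasSum_siteProb hphi).summable, (hlam.hasSum_siteProb hphi).tsum_eq, ENNReal.ofReal_one]

lemma IsJumpRate.siteMeasure_zero_pos (hlam : IsJumpRate lam) {phi : ℝ} (hphi : 0 ≤ phi) :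
    0 < siteMeasure lam phi {0} := by
  rw [← lintegral_indicator_one (measurableSet_singleton 0), lintegral_siteMeasure]
  refine lt_of_lt_of_le ?_ (ENNReal.le_tsum 0)
  simp [siteProb, weight_zero, hlam.partitionFn_pos hphi]

/-- The detailed balance identity for the one-site law. -/
lemma IsJumpRate.lintegral_rate_mul (hlam : IsJumpRate lam) {phi : ℝ} (hphi : 0 ≤ phi)
    (g : ℕ → ℝ≥0∞) :
    ∫⁻ k, ENNReal.ofReal (lam k) * g (k - 1) ∂siteMeasure lam phi
      = ENNReal.ofReal phi * ∫⁻ k, g k ∂siteMeasure lam phi := by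
  -- The truncated `k - 1` is harmless at `k = 0`, where the rate vanishes; the other terms are
  -- shifted by one.
  rw [lintegral_siteMeasure, lintegral_siteMeasure, tsum_eq_zero_add' ENNReal.summable,
    ← ENNReal.tsum_mul_left]
  simp only [hlam.zero, ENNReal.ofReal_zero, zero_mul, mul_zero, zero_add, Nat.add_sub_cancel]
  refine tsum_congr fun k => ?_
  rw [← mul_assoc, ← mul_assoc, ← ENNReal.ofReal_mul (hlam.siteProb_nonneg hphi _),
    ← ENNReal.ofReal_mul hphi, siteProb, siteProb, div_mul_eq_mul_div,
    mul_comm (weight lam phi (k + 1)), hlam.mul_weight_succ, mul_div_assoc]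

lemma IsJumpRate.lintegral_cast (hlam : IsJumpRate lam) {rho : ℝ} (hrho : 0 < rho) :
    ∫⁻ k, ENNReal.ofReal (k : ℝ) ∂siteMeasure lam (fugacity lam rho) = ENNReal.ofReal rho := by
  have hphi := hlam.fugacity_nonneg hrho
  have h := hlam.hasSum_fugacity hrho
  rw [lintegral_siteMeasure]
  conv_rhs => rw [← h.tsum_eq]
  rw [ENNReal.ofReal_tsum_of_nonneg
    (fun k => mul_nonneg k.cast_nonneg (hlam.siteProb_nonneg hphi k)) h.summable]
  refine tsum_congr fun k => ?_
  rw [mul_comm, ENNReal.ofReal_mul k.cast_nonneg]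

lemma IsSuperlinearWeight.lintegral_ne_top {d : ℕ} {w : ℝ → ℝ} (hlam : IsJumpRate lam)
    (hw : IsSuperlinearWeight lam d w) {rho : ℝ} (hrho : 0 < rho) :
    ∫⁻ k, ENNReal.ofReal (w (k : ℝ)) ∂siteMeasure lam (fugacity lam rho) ≠ ∞ := by
  have := hlam.isProbabilityMeasure (hlam.fugacity_nonneg hrho)
  obtain ⟨theta, htheta, hint⟩ := hw.exp_integrable rho hrho.le
  have hmp : MeasurePreserving (fun eta : Config d => eta 0) (equilibrium lam d rho)
      (siteMeasure lam (fugacity lam rho)) :=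
    measurePreserving_eval_infinitePi (fun _ : Site d => siteMeasure lam (fugacity lam rho)) 0
  have h1 : Integrable (fun k : ℕ => Real.exp (theta * w (k : ℝ)))
      (siteMeasure lam (fugacity lam rho)) :=
    (hmp.integrable_comp (measurable_of_countable _).aestronglyMeasurable).1 hint
  have h2 : Integrable (fun k : ℕ => w (k : ℝ)) (siteMeasure lam (fugacity lam rho)) := by
    -- Domination by the exponential moment: `theta * w ≤ exp (theta * w)`.
    refine (h1.const_mul theta⁻¹).mono (measurable_of_countable _).aestronglyMeasurable
      (Eventually.of_forall fun k => ?_)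
    have hk := hw.nonneg k k.cast_nonneg
    rw [Real.norm_of_nonneg hk, Real.norm_of_nonneg (by positivity), inv_mul_eq_div,
      le_div_iff₀ htheta]
    linarith [Real.add_one_le_exp (theta * w (k : ℝ))]
  exact (h2.lintegral_lt_top).ne

end Site

/-! ### Cutoff profiles on the lattice and their Dirichlet energy. -/

section Lattice

variable {d : ℕ}

lemma mem_box {n : ℕ} {x y : Site d} : y ∈ box n x ↔ ‖y - x‖ ≤ n := by
  rw [box, Finset.mem_Icc, Pi.le_def, Pi.le_def, ← forall_and,
    pi_norm_le_iff_of_nonneg n.cast_nonneg]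
  refine forall_congr' fun i => ?_
  rw [Pi.sub_apply, Pi.sub_apply, Pi.add_apply, Int.norm_eq_abs, ← Int.cast_abs]
  have : ((|y i - x i| : ℤ) : ℝ) ≤ (n : ℝ) ↔ |y i - x i| ≤ (n : ℤ) := by
    rw [← Int.cast_natCast n, Int.cast_le]
  rw [this, abs_le]
  constructor <;> rintro ⟨h1, h2⟩ <;> constructor <;> linarith

lemma card_box (n : ℕ) (x : Site d) : (box n x).card = (2 * n + 1) ^ d := by
  rw [box, Pi.card_Icc]
  have : ∀ i, (Finset.Icc ((x - fun _ => (n : ℤ) : Site d) i) ((x + fun _ => (n : ℤ) : Site d) i)).card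
      = 2 * n + 1 := by
    intro i
    rw [Int.card_Icc, Pi.add_apply, Pi.sub_apply]
    omega
  rw [Finset.prod_congr rfl fun i _ => this i]
  simp

lemma Adj.norm_sub_le {x y : Site d} (h : Adj x y) : ‖x - y‖ ≤ 1 := by
  refine (pi_norm_le_iff_of_nonneg zero_le_one).2 fun i => ?_
  have h1 : |x i - y i| ≤ 1 := by
    rw [← h]
    exact Finset.single_le_sum (f := fun i => |x i - y i|) (fun i _ => abs_nonneg _)
      (Finset.mem_univ i)
  rw [Pi.sub_apply, Int.norm_eq_abs, ← Int.cast_abs]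
  exact_mod_cast h1

lemma Adj.ne {x y : Site d} (h : Adj x y) : x ≠ y := by
  rintro rfl
  simp [Adj] at h

/-- The sum of the squared increments of `ψ` over ordered pairs of nearest neighbours. -/
def energy (ψ : Site d → ℝ) : ℝ≥0∞ :=
  ∑' p : {p : Site d × Site d // Adj p.1 p.2}, ENNReal.ofReal ((ψ p.1.2 - ψ p.1.1) ^ 2)

/-- Only bonds starting in the box of radius `n` contribute, and each of its sites has at most `3 ^
d` neighbours in the sup norm. -/
lemma energy_le {ψ : Site d → ℝ} {c : ℝ} (n : ℕ)
    (hc : ∀ x y, Adj x y → (ψ y - ψ x) ^ 2 ≤ c)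
    (hout : ∀ x y, Adj x y → (n : ℝ) < ‖x‖ → ψ y = ψ x) :
    energy ψ ≤ ((2 * n + 1) ^ d * 3 ^ d : ℕ) * ENNReal.ofReal c := by
  classical
  let T : Finset (Site d × Site d) :=
    ((box n 0) ×ˢ (box 1 (0 : Site d))).image fun q => (q.1, q.1 + q.2)
  have hT : T.card ≤ (2 * n + 1) ^ d * 3 ^ d := by
    refine Finset.card_image_le.trans_eq ?_
    rw [Finset.card_product, card_box, card_box]
  calc energy ψ ≤ ∑' p : {p : Site d × Site d // Adj p.1 p.2},
        (T : Set (Site d × Site d)).indicator (fun _ => ENNReal.ofReal c) p.1 := by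
        refine ENNReal.tsum_le_tsum fun p => ?_
        by_cases hp : p.1 ∈ (T : Set (Site d × Site d))
        · rw [Set.indicator_of_mem hp]
          exact ENNReal.ofReal_le_ofReal (hc _ _ p.2)
        · have hx : (n : ℝ) < ‖p.1.1‖ := by
            by_contra! hx
            refine hp (Finset.mem_coe.2 (Finset.mem_image.2
              ⟨(p.1.1, p.1.2 - p.1.1), Finset.mem_product.2 ⟨?_, ?_⟩, ?_⟩))
            · simpa [mem_box] using hx
            · simpa [mem_box, norm_sub_rev] using p.2.norm_sub_le
            · simp
          simp [hout _ _ p.2 hx]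
    _ ≤ ∑' p, (T : Set (Site d × Site d)).indicator (fun _ => ENNReal.ofReal c) p :=
        ENNReal.tsum_comp_le_tsum_of_injective Subtype.val_injective _
    _ = T.card * ENNReal.ofReal c := by
        rw [← tsum_subtype, Finset.tsum_subtype' T fun _ => ENNReal.ofReal c]
        simp
    _ ≤ _ := by gcongr

/-- The piecewise linear function of `‖z‖` that vanishes for `‖z‖ ≤ m` and equals `1` for
`‖z‖ ≥ 2 m`. -/
def cutoff (m : ℕ) (z : Site d) : ℝ := max 0 (min 1 (‖z‖ / m - 1))

lemma cutoff_nonneg (m : ℕ) (z : Site d) : 0 ≤ cutoff m z := le_max_left _ _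

lemma cutoff_le_one (m : ℕ) (z : Site d) : cutoff m z ≤ 1 :=
  max_le zero_le_one (min_le_left _ _)

lemma cutoff_eq_zero {m : ℕ} {z : Site d} (h : ‖z‖ ≤ m) : cutoff m z = 0 := by
  refine max_eq_left ((min_le_right _ _).trans ?_)
  linarith [div_le_one_of_le₀ h m.cast_nonneg]

lemma cutoff_eq_one {m : ℕ} (hm : 1 ≤ m) {z : Site d} (h : 2 * (m : ℝ) ≤ ‖z‖) :
    cutoff m z = 1 := by
  have hm' : (0 : ℝ) < m := by exact_mod_cast hm
  have : 2 ≤ ‖z‖ / m := (le_div_iff₀ hm').2 h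
  rw [cutoff, min_eq_left (by linarith), max_eq_right zero_le_one]

lemma abs_cutoff_sub_le (m : ℕ) (x y : Site d) :
    |cutoff m y - cutoff m x| ≤ ‖x - y‖ / m := by
  refine (abs_max_sub_max_le_max _ _ _ _).trans ?_
  rw [sub_self, abs_zero, max_eq_right (abs_nonneg _)]
  refine (abs_min_sub_min_le_max _ _ _ _).trans ?_
  rw [sub_self, abs_zero, max_eq_right (abs_nonneg _), sub_sub_sub_cancel_right, ← sub_div,
    abs_div, Nat.abs_cast, norm_sub_rev]
  exact div_le_div_of_nonneg_right (abs_norm_sub_norm_le _ _) m.cast_nonneg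

lemma cutoff_eq_of_adj_of_lt {m : ℕ} (hm : 1 ≤ m) {x y : Site d} (h : Adj x y)
    (hx : 2 * (m : ℝ) + 1 < ‖x‖) : cutoff m y = cutoff m x := by
  have h1 := h.norm_sub_le
  have h2 := norm_sub_norm_le x y
  rw [cutoff_eq_one hm (by linarith), cutoff_eq_one hm (by linarith)]

lemma cutoff_eq_of_adj_of_le {m : ℕ} {x y : Site d} (h : Adj x y)
    (hx : ‖x‖ ≤ (m : ℝ) - 1) : cutoff m y = cutoff m x := by
  have h1 := h.norm_sub_le
  have h2 := norm_sub_norm_le y x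
  rw [norm_sub_rev] at h2
  rw [cutoff_eq_zero (by linarith), cutoff_eq_zero (by linarith)]

/-- About `m ^ d` bonds carry an increment of at most `1 / m`. The constant `63` is generous: `3 *
(4 * m + 3) ≤ 21 * m` already holds. -/
lemma energy_cutoff_le {m : ℕ} (hm : 1 ≤ m) :
    energy (cutoff (d := d) m) ≤ ENNReal.ofReal (63 ^ d * ((m : ℝ) ^ d / (m : ℝ) ^ 2)) := by
  refine (energy_le (c := 1 / (m : ℝ) ^ 2) (2 * m + 1) (fun x y h => ?_) fun x y h hx => ?_).trans
    ?_
  · rw [← sq_abs, ← one_div_pow]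
    exact pow_le_pow_left₀ (abs_nonneg _) ((abs_cutoff_sub_le m x y).trans
      (div_le_div_of_nonneg_right h.norm_sub_le m.cast_nonneg)) 2
  · exact cutoff_eq_of_adj_of_lt hm h (by simpa using hx)
  · rw [← ENNReal.ofReal_natCast, ← ENNReal.ofReal_mul (Nat.cast_nonneg _)]
    refine ENNReal.ofReal_le_ofReal ?_
    rw [mul_one_div, ← mul_div_assoc]
    refine div_le_div_of_nonneg_right ?_ (by positivity)
    have h1 : (2 * (2 * m + 1) + 1) ^ d * 3 ^ d ≤ 63 ^ d * m ^ d := by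
      rw [← mul_pow, ← mul_pow]
      exact Nat.pow_le_pow_left (by omega) d
    exact_mod_cast h1

/-- The average of cutoffs at `K` separated scales. -/
def multiCutoff (m K : ℕ) (z : Site d) : ℝ :=
  (∑ j ∈ Finset.range K, cutoff (m * 4 ^ j) z) / K

/-- The cutoff at scale `n` varies only on bonds starting at norm between `n - 1` and `2 n + 1`.
With ratio `4` between scales these shells are disjoint, so all cross terms vanish. -/
lemma sq_sum_cutoff_increment {m : ℕ} (hm : 1 ≤ m) (K : ℕ) {x y : Site d} (h : Adj x y) :
    (∑ j ∈ Finset.range K, (cutoff (m * 4 ^ j) y - cutoff (m * 4 ^ j) x)) ^ 2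
      = ∑ j ∈ Finset.range K, (cutoff (m * 4 ^ j) y - cutoff (m * 4 ^ j) x) ^ 2 := by
  have hpos : ∀ j, 1 ≤ m * 4 ^ j := fun j => Nat.mul_pos hm (by positivity)
  have hlt : ∀ i j, i < j → (cutoff (m * 4 ^ i) y - cutoff (m * 4 ^ i) x)
      * (cutoff (m * 4 ^ j) y - cutoff (m * 4 ^ j) x) = 0 := by
    intro i j hij
    rcases lt_or_ge (2 * ((m * 4 ^ i : ℕ) : ℝ) + 1) ‖x‖ with hx | hx
    · rw [cutoff_eq_of_adj_of_lt (hpos i) h hx, sub_self, zero_mul]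
    · have h1 : 2 * (m * 4 ^ i) + 2 ≤ m * 4 ^ j := by
        have h2 : 4 ^ (i + 1) ≤ 4 ^ j := Nat.pow_le_pow_right (by norm_num) hij
        have h3 : m * 4 ^ (i + 1) ≤ m * 4 ^ j := Nat.mul_le_mul_left m h2
        have h4 := hpos i
        rw [pow_succ, ← mul_assoc] at h3
        omega
      have h5 : 2 * ((m * 4 ^ i : ℕ) : ℝ) + 2 ≤ ((m * 4 ^ j : ℕ) : ℝ) := by exact_mod_cast h1
      rw [cutoff_eq_of_adj_of_le (m := m * 4 ^ j) h (by linarith), sub_self, mul_zero]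
  rw [sq, Finset.sum_mul_sum]
  refine Finset.sum_congr rfl fun i hi => ?_
  rw [Finset.sum_eq_single_of_mem i hi, sq]
  intro j _ hji
  rcases lt_or_gt_of_ne hji with hj | hj
  · rw [mul_comm, hlt j i hj]
  · exact hlt i j hj

/-- Averaging `K` profiles of disjoint variation divides the sum of their energies by `K ^ 2`. When
each energy is bounded, as in dimension two, the result is of order `1 / K`: a discrete logarithmic
profile. -/
lemma energy_multiCutoff_le {m : ℕ} (hm : 1 ≤ m) (K : ℕ) :
    energy (multiCutoff (d := d) m K)
      ≤ ENNReal.ofReal (((K : ℝ) ^ 2)⁻¹) *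
        ∑ j ∈ Finset.range K, energy (cutoff (d := d) (m * 4 ^ j)) := by
  unfold energy
  rw [← Summable.tsum_finsetSum fun _ _ => ENNReal.summable, ← ENNReal.tsum_mul_left]
  refine ENNReal.tsum_le_tsum fun p => le_of_eq ?_
  rw [← ENNReal.ofReal_sum_of_nonneg fun _ _ => sq_nonneg _, ← ENNReal.ofReal_mul (by positivity),
    ← sq_sum_cutoff_increment hm K p.2, multiCutoff, multiCutoff, ← sub_div,
    ← Finset.sum_sub_distrib, div_pow, inv_mul_eq_div]

lemma multiCutoff_nonneg (m K : ℕ) (z : Site d) : 0 ≤ multiCutoff m K z :=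
  div_nonneg (Finset.sum_nonneg fun _ _ => cutoff_nonneg _ _) K.cast_nonneg

lemma multiCutoff_le_one (m K : ℕ) (z : Site d) : multiCutoff m K z ≤ 1 := by
  refine div_le_one_of_le₀ ?_ K.cast_nonneg
  refine (Finset.sum_le_sum fun j _ => cutoff_le_one (m * 4 ^ j) z).trans ?_
  simp

lemma multiCutoff_eq_zero {m : ℕ} (K : ℕ) {z : Site d} (h : ‖z‖ ≤ m) :
    multiCutoff m K z = 0 := by
  rw [multiCutoff, Finset.sum_eq_zero, zero_div]
  intro j _
  refine cutoff_eq_zero (h.trans ?_)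
  exact_mod_cast Nat.le_mul_of_pos_right m (by positivity)

lemma multiCutoff_eq_one {m K : ℕ} (hm : 1 ≤ m) (hK : 1 ≤ K) {z : Site d}
    (h : 2 * ((m * 4 ^ K : ℕ) : ℝ) ≤ ‖z‖) : multiCutoff m K z = 1 := by
  have h1 : ∀ j ∈ Finset.range K, cutoff (m * 4 ^ j) z = 1 := by
    intro j hj
    refine cutoff_eq_one (Nat.mul_pos hm (by positivity)) (le_trans ?_ h)
    have : m * 4 ^ j ≤ m * 4 ^ K := Nat.mul_le_mul_left m
      (Nat.pow_le_pow_right (by norm_num) (Finset.mem_range.1 hj).le)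
    have : ((m * 4 ^ j : ℕ) : ℝ) ≤ ((m * 4 ^ K : ℕ) : ℝ) := by exact_mod_cast this
    linarith
  rw [multiCutoff, Finset.sum_congr rfl h1]
  have : (K : ℝ) ≠ 0 := by positivity
  simp [this]

/-- In dimension at least two, a box can be insulated from infinity at a cost that is
arbitrarily small on the scale `N ^ (d - 2)`. -/
lemma exists_profile (hd : 2 ≤ d) (l : ℕ) {κ : ℝ} (hκ : 0 < κ) :
    ∃ (ψ : Site d → ℝ) (R : ℕ), (∀ z, 0 ≤ ψ z) ∧ (∀ z, ψ z ≤ 1) ∧ (∀ z, ‖z‖ ≤ l → ψ z = 0) ∧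
      (∀ z, (R : ℝ) ≤ ‖z‖ → ψ z = 1) ∧
      ∀ᶠ N : ℕ in atTop,
        ENNReal.ofReal ((N : ℝ) ^ ((2 : ℤ) - (d : ℤ))) * energy ψ ≤ ENNReal.ofReal κ := by
  have hl : ∀ z : Site d, ‖z‖ ≤ l → ‖z‖ ≤ (l + 1 : ℕ) := fun z hz => by push_cast; linarith
  rcases hd.eq_or_lt with rfl | hd
  -- In dimension two the power of `N` is trivial, so the profile itself must have small energy; `K`
  -- scales give at most `63 ^ 2 / K`.
  · obtain ⟨K, hK⟩ := exists_nat_gt (63 ^ 2 / κ)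
    have hK0 : (0 : ℝ) < K := lt_of_le_of_lt (by positivity) hK
    have hK1 : 1 ≤ K := by exact_mod_cast hK0
    refine ⟨multiCutoff (l + 1) K, 2 * ((l + 1) * 4 ^ K), multiCutoff_nonneg _ _,
      multiCutoff_le_one _ _, fun z hz => multiCutoff_eq_zero K (hl z hz),
      fun z hz => multiCutoff_eq_one (by omega) hK1 (by exact_mod_cast hz),
      Eventually.of_forall fun N => ?_⟩
    have hj : ∀ j ∈ Finset.range K, energy (cutoff (d := 2) ((l + 1) * 4 ^ j))
        ≤ ENNReal.ofReal (63 ^ 2) := by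
      intro j _
      have h1 : 1 ≤ (l + 1) * 4 ^ j := Nat.mul_pos (by omega) (by positivity)
      refine (energy_cutoff_le h1).trans (le_of_eq ?_)
      rw [div_self, mul_one]
      positivity
    simp only [Nat.cast_ofNat, sub_self, zpow_zero, ENNReal.ofReal_one, one_mul]
    refine (energy_multiCutoff_le (by omega) K).trans ?_
    refine (mul_le_mul_right (Finset.sum_le_sum hj) _).trans ?_
    rw [Finset.sum_const, Finset.card_range, nsmul_eq_mul, ← ENNReal.ofReal_natCast,
      ← ENNReal.ofReal_mul (by positivity), ← ENNReal.ofReal_mul (by positivity)]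
    refine ENNReal.ofReal_le_ofReal ?_
    have h2 : 63 ^ 2 ≤ κ * K := by
      rw [div_lt_iff₀ hκ] at hK
      linarith
    rw [inv_mul_le_iff₀ (by positivity)]
    nlinarith
  -- One cutoff at a fixed scale suffices: its energy is fixed, and `N ^ (2 - d) ≤ 1 / N`.
  · refine ⟨cutoff (l + 1), 2 * (l + 1), cutoff_nonneg _, cutoff_le_one _,
      fun z hz => cutoff_eq_zero (hl z hz),
      fun z hz => cutoff_eq_one (by omega) (by exact_mod_cast hz), ?_⟩
    set E : ℝ := 63 ^ d * (((l + 1 : ℕ) : ℝ) ^ d / ((l + 1 : ℕ) : ℝ) ^ 2) with hE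
    have hE0 : 0 ≤ E := by positivity
    obtain ⟨N₀, hN₀⟩ := exists_nat_gt (E / κ)
    filter_upwards [eventually_ge_atTop (max N₀ 1)] with N hN
    have hN1 : (1 : ℝ) ≤ N := by exact_mod_cast (le_max_right _ _).trans hN
    have hN2 : (N₀ : ℝ) ≤ N := by exact_mod_cast (le_max_left _ _).trans hN
    refine (mul_le_mul_right (energy_cutoff_le (by omega)) _).trans ?_
    rw [← ENNReal.ofReal_mul (by positivity)]
    refine ENNReal.ofReal_le_ofReal ?_
    have h1 : (N : ℝ) ^ ((2 : ℤ) - (d : ℤ)) ≤ (N : ℝ) ^ (-1 : ℤ) :=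
      zpow_le_zpow_right₀ hN1 (by omega)
    rw [zpow_neg_one] at h1
    refine (mul_le_mul_of_nonneg_right h1 hE0).trans ?_
    rw [inv_mul_le_iff₀ (by linarith), mul_comm]
    rw [div_lt_iff₀ hκ] at hN₀
    nlinarith

/-- The scaled energy is of order `(m / N) ^ (d - 2)`, and `m / N ≤ eps ≤ 1`. The exponent is at
least one precisely when `d ≥ 3`. -/
lemma energy_cutoff_scaled_le (hd : 3 ≤ d) {m N : ℕ} (hm : 1 ≤ m) {eps : ℝ} (heps : eps ≤ 1)
    (hmN : (m : ℝ) ≤ N * eps) :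
    ENNReal.ofReal ((N : ℝ) ^ ((2 : ℤ) - (d : ℤ))) * energy (cutoff (d := d) m)
      ≤ ENNReal.ofReal (63 ^ d * eps) := by
  have hm0 : (0 : ℝ) < m := by exact_mod_cast hm
  have hN0 : (0 : ℝ) < N := by
    rcases N.cast_nonneg.lt_or_eq (α := ℝ) with h | h
    · exact h
    · rw [← h, zero_mul] at hmN
      linarith
  have hr : (m : ℝ) / N ≤ eps := (div_le_iff₀ hN0).2 (by linarith)
  have hr0 : 0 ≤ (m : ℝ) / N := by positivity
  refine (mul_le_mul_right (energy_cutoff_le hm) _).trans ?_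
  rw [← ENNReal.ofReal_mul (by positivity)]
  refine ENNReal.ofReal_le_ofReal ?_
  obtain ⟨k, rfl⟩ : ∃ k, d = k + 1 + 2 := ⟨d - 3, by omega⟩
  have h1 : (N : ℝ) ^ ((2 : ℤ) - ((k + 1 + 2 : ℕ) : ℤ)) = ((N : ℝ) ^ (k + 1))⁻¹ := by
    rw [← zpow_natCast, ← zpow_neg]
    congr 1
  have h2 : (m : ℝ) ^ (k + 1 + 2) / (m : ℝ) ^ 2 = (m : ℝ) ^ (k + 1) := by
    rw [pow_add _ (k + 1) 2]
    field_simp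
  have h3 : ((m : ℝ) / N) ^ (k + 1) ≤ eps :=
    (pow_le_of_le_one hr0 (hr.trans heps) (by omega)).trans hr
  rw [h1, h2]
  calc ((N : ℝ) ^ (k + 1))⁻¹ * (63 ^ (k + 1 + 2) * (m : ℝ) ^ (k + 1))
      = 63 ^ (k + 1 + 2) * ((m : ℝ) / N) ^ (k + 1) := by rw [div_pow]; ring
    _ ≤ _ := by gcongr

end Lattice

/-! ### Tilted one-site laws. -/

section Tilt

variable {σ : Measure ℕ} {t : ℝ}

/-- The normalising constant of the site law tilted by `t ^ (2 k)`. -/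
def tiltNorm (σ : Measure ℕ) (t : ℝ) : ℝ≥0∞ := ∫⁻ k, ENNReal.ofReal (t ^ (2 * k)) ∂σ

/-- The density, with respect to the site law, of its tilt by `t ^ (2 k)`. -/
def tilt (σ : Measure ℕ) (t : ℝ) (k : ℕ) : ℝ := t ^ (2 * k) / (tiltNorm σ t).toReal

lemma tilt_nonneg (σ : Measure ℕ) (t : ℝ) (k : ℕ) : 0 ≤ tilt σ t k :=
  div_nonneg ((even_two_mul k).pow_nonneg t) ENNReal.toReal_nonneg

/-- The tilt has weight `1` at `k = 0`, even for `t = 0`, so the atom at zero bounds the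
normalisation below uniformly in `t`. -/
lemma le_tiltNorm (σ : Measure ℕ) (t : ℝ) : σ {0} ≤ tiltNorm σ t := by
  rw [← lintegral_indicator_one (measurableSet_singleton 0)]
  refine lintegral_mono fun k => ?_
  by_cases hk : k = 0 <;> simp [hk]

lemma tiltNorm_le_one [IsProbabilityMeasure σ] (h0 : 0 ≤ t) (h1 : t ≤ 1) :
    tiltNorm σ t ≤ 1 := by
  refine (lintegral_mono fun k => ENNReal.ofReal_le_one.2 (pow_le_one₀ h0 h1)).trans ?_
  simp

lemma ofReal_tilt [IsProbabilityMeasure σ] (hσ : 0 < σ {0}) (h0 : 0 ≤ t) (h1 : t ≤ 1) (k : ℕ) :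
    ENNReal.ofReal (tilt σ t k) = ENNReal.ofReal (t ^ (2 * k)) / tiltNorm σ t := by
  have hne : tiltNorm σ t ≠ ∞ := ne_top_of_le_ne_top ENNReal.one_ne_top (tiltNorm_le_one h0 h1)
  have hpos : tiltNorm σ t ≠ 0 := (hσ.trans_le (le_tiltNorm σ t)).ne'
  rw [tilt, ENNReal.ofReal_div_of_pos (ENNReal.toReal_pos hpos hne), ENNReal.ofReal_toReal hne]

lemma lintegral_tilt [IsProbabilityMeasure σ] (hσ : 0 < σ {0}) (h0 : 0 ≤ t) (h1 : t ≤ 1) :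
    ∫⁻ k, ENNReal.ofReal (tilt σ t k) ∂σ = 1 := by
  have hne : tiltNorm σ t ≠ ∞ := ne_top_of_le_ne_top ENNReal.one_ne_top (tiltNorm_le_one h0 h1)
  have hpos : tiltNorm σ t ≠ 0 := (hσ.trans_le (le_tiltNorm σ t)).ne'
  simp only [ofReal_tilt hσ h0 h1, div_eq_mul_inv]
  rw [lintegral_mul_const _ (measurable_of_countable _), ← tiltNorm,
    ENNReal.mul_inv_cancel hpos hne]

lemma ofReal_tilt_le [IsProbabilityMeasure σ] (hσ : 0 < σ {0}) (h0 : 0 ≤ t) (h1 : t ≤ 1)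
    (k : ℕ) : ENNReal.ofReal (tilt σ t k) ≤ (σ {0})⁻¹ := by
  rw [ofReal_tilt hσ h0 h1, ← one_div]
  exact ENNReal.div_le_div (ENNReal.ofReal_le_one.2 (pow_le_one₀ h0 h1)) (le_tiltNorm σ t)

lemma tilt_one [IsProbabilityMeasure σ] (k : ℕ) : tilt σ 1 k = 1 := by
  simp [tilt, tiltNorm]

lemma tilt_zero {k : ℕ} (hk : k ≠ 0) : tilt σ 0 k = 0 := by
  simp [tilt, hk]

end Tilt

/-! ### Product densities with a given profile and their Dirichlet form. -/

section Profile

variable {d : ℕ} {σ : Measure ℕ} {ψ : Site d → ℝ} {B : Finset (Site d)}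

lemma lintegral_infinitePi_prod {ι : Type*} [IsProbabilityMeasure σ] (s : Finset ι)
    (g : ι → ℕ → ℝ≥0∞) :
    ∫⁻ eta, ∏ i ∈ s, g i (eta i) ∂Measure.infinitePi (fun _ : ι => σ)
      = ∏ i ∈ s, ∫⁻ k, g i k ∂σ := by
  have hg : ∀ i, Measurable (g i) := fun i => measurable_of_countable _
  rw [ProbabilityTheory.lintegral_prod_eq_prod_lintegral_of_indepFun s (fun i (eta : ι → ℕ) => g i (eta i))
    (ProbabilityTheory.iIndepFun_infinitePi hg) fun i => (hg i).comp (measurable_pi_apply i)]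
  exact Finset.prod_congr rfl fun i _ =>
    (measurePreserving_eval_infinitePi (fun _ : ι => σ) i).lintegral_comp (hg i)

/-- The density of the product of the tilted site laws, with tilts given by `ψ`; here `ψ = 1`
outside `B`. -/
def profileDensity (σ : Measure ℕ) (B : Finset (Site d)) (ψ : Site d → ℝ) (eta : Config d) : ℝ :=
  ∏ z ∈ B, tilt σ (ψ z) (eta z)

/-- Sites with `ψ = 1` contribute the factor `1`, so the product may be enlarged to include any
sites under study. -/
lemma profileDensity_eq_of_subset [IsProbabilityMeasure σ] (hB : ∀ z, z ∉ B → ψ z = 1)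
    {s : Finset (Site d)} (hs : B ⊆ s) (eta : Config d) :
    profileDensity σ B ψ eta = ∏ z ∈ s, tilt σ (ψ z) (eta z) :=
  Finset.prod_subset hs fun z _ hz => by rw [hB z hz, tilt_one]

lemma measurable_profileDensity : Measurable (profileDensity σ B ψ) :=
  Finset.measurable_fun_prod _ fun z _ =>
    (measurable_of_countable (tilt σ (ψ z))).comp (measurable_pi_apply z)

lemma lintegral_profileDensity_mul [IsProbabilityMeasure σ] (hσ : 0 < σ {0})
    (h0 : ∀ z, 0 ≤ ψ z) (h1 : ∀ z, ψ z ≤ 1) (hB : ∀ z, z ∉ B → ψ z = 1) (z : Site d)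
    (g : ℕ → ℝ≥0∞) :
    ∫⁻ eta, ENNReal.ofReal (profileDensity σ B ψ eta) * g (eta z)
        ∂Measure.infinitePi (fun _ : Site d => σ)
      = ∫⁻ k, ENNReal.ofReal (tilt σ (ψ z) k) * g k ∂σ := by
  classical
  have key : ∀ eta : Config d, ENNReal.ofReal (profileDensity σ B ψ eta) * g (eta z)
      = ∏ i ∈ insert z B, (ENNReal.ofReal (tilt σ (ψ i) (eta i)) *
          if i = z then g (eta i) else 1) := by
    intro eta
    rw [profileDensity_eq_of_subset hB (Finset.subset_insert z B),
      ENNReal.ofReal_prod_of_nonneg fun _ _ => tilt_nonneg _ _ _, Finset.prod_mul_distrib,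
      Finset.prod_ite_eq' _ z fun i => g (eta i), if_pos (Finset.mem_insert_self z B)]
  simp only [key]
  rw [lintegral_infinitePi_prod (insert z B)
    (fun i k => ENNReal.ofReal (tilt σ (ψ i) k) * if i = z then g k else 1),
    Finset.prod_eq_single_of_mem z (Finset.mem_insert_self z B)]
  · simp
  · intro i _ hi
    simp [hi, lintegral_tilt hσ (h0 i) (h1 i)]

lemma profileDensity_mem_densities [IsProbabilityMeasure σ] (hσ : 0 < σ {0})
    (h0 : ∀ z, 0 ≤ ψ z) (h1 : ∀ z, ψ z ≤ 1) (hB : ∀ z, z ∉ B → ψ z = 1) :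
    profileDensity σ B ψ ∈ densities (Measure.infinitePi (fun _ : Site d => σ)) := by
  refine ⟨measurable_profileDensity, fun eta => Finset.prod_nonneg fun _ _ => tilt_nonneg _ _ _,
    ?_⟩
  have h := lintegral_profileDensity_mul hσ h0 h1 hB 0 fun _ => 1
  simpa [lintegral_tilt hσ (h0 0) (h1 0)] using h

/-- Let `ζ` be `η` with one particle removed at `x`. The square roots of the density at `η + 1_y -
1_x` and at `η` are `ψ y` and `ψ x` times the square root at `ζ`. The integrand is thus `(ψ y - ψ x)
^ 2` times the rate times the density at `ζ`, and detailed balance at `x` integrates the last two to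
`phi`. -/
lemma bondDirichlet_profileDensity_le [IsProbabilityMeasure σ] (hσ : 0 < σ {0})
    (h0 : ∀ z, 0 ≤ ψ z) (h1 : ∀ z, ψ z ≤ 1) (hB : ∀ z, z ∉ B → ψ z = 1) {lam : ℕ → ℝ}
    (hlam : IsJumpRate lam) {phi : ℝ}
    (hbal : ∀ g : ℕ → ℝ≥0∞, ∫⁻ k, ENNReal.ofReal (lam k) * g (k - 1) ∂σ
      = ENNReal.ofReal phi * ∫⁻ k, g k ∂σ) {x y : Site d} (hxy : Adj x y) :
    bondDirichlet lam (Measure.infinitePi (fun _ : Site d => σ)) (profileDensity σ B ψ) x y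
      ≤ ENNReal.ofReal phi * ENNReal.ofReal ((ψ y - ψ x) ^ 2) := by
  classical
  set s : Finset (Site d) := insert x (insert y B) with hs
  have hx : x ∈ s := by simp [hs]
  have hy : y ∈ s := by simp [hs]
  have hBs : B ⊆ s := fun z hz => by simp [hs, hz]
  -- The square root of the one-site tilt, geometric in `k` with ratio `ψ z`.
  let b : Site d → ℕ → ℝ := fun z k => ψ z ^ k / √(tiltNorm σ (ψ z)).toReal
  have hb0 : ∀ z k, 0 ≤ b z k := fun z k => div_nonneg (pow_nonneg (h0 z) k) (Real.sqrt_nonneg _)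
  have hbsq : ∀ z k, b z k ^ 2 = tilt σ (ψ z) k := fun z k => by
    rw [tilt, div_pow, Real.sq_sqrt ENNReal.toReal_nonneg, ← pow_mul, mul_comm]
  have hbsucc : ∀ z k, b z (k + 1) = ψ z * b z k := fun z k => by
    simp only [b, pow_succ]; ring
  have hsqrt : ∀ eta : Config d, √(profileDensity σ B ψ eta) = ∏ z ∈ s, b z (eta z) := by
    intro eta
    rw [profileDensity_eq_of_subset hB hBs, ← Finset.prod_congr rfl fun z _ => hbsq z (eta z),
      Finset.prod_pow, Real.sqrt_sq (Finset.prod_nonneg fun z _ => hb0 z _)]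
  let g : Site d → ℕ → ℝ≥0∞ := fun z k =>
    if z = x then ENNReal.ofReal (lam k) * ENNReal.ofReal (tilt σ (ψ z) (k - 1))
    else ENNReal.ofReal (tilt σ (ψ z) k)
  have hpt : ∀ eta : Config d, ENNReal.ofReal (lam (eta x) *
      (√(profileDensity σ B ψ (move eta x y)) - √(profileDensity σ B ψ eta)) ^ 2)
      ≤ ENNReal.ofReal ((ψ y - ψ x) ^ 2) * ∏ z ∈ s, g z (eta z) := by
    intro eta
    rcases Nat.eq_zero_or_pos (eta x) with hz | hpos
    · simp [hz, hlam.zero]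
    obtain ⟨k, hk⟩ : ∃ k, eta x = k + 1 := ⟨eta x - 1, by omega⟩
    let zeta : Config d := Function.update eta x k
    have hz1 : ∀ z, eta z = if z = x then zeta z + 1 else zeta z := by
      intro z
      by_cases h : z = x
      · subst h; simp [zeta, hk]
      · simp [zeta, h]
    have hz2 : ∀ z, move eta x y z = if z = y then zeta z + 1 else zeta z := by
      intro z
      by_cases h : z = x
      · subst h; simp [move, zeta, hk, hxy.ne]
      · by_cases h' : z = y
        · subst h'; simp [move, zeta, h]
        · simp [move, zeta, h, h']
    have hstep : ∀ (v : Site d) (xi : Config d), v ∈ s →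
        (∀ z, xi z = if z = v then zeta z + 1 else zeta z) →
        ∏ z ∈ s, b z (xi z) = ψ v * ∏ z ∈ s, b z (zeta z) := by
      intro v xi hv hxi
      have : ∀ z ∈ s, b z (xi z) = (if z = v then ψ z else 1) * b z (zeta z) := by
        intro z _
        rw [hxi z]
        split_ifs with h
        · exact hbsucc z _
        · rw [one_mul]
      rw [Finset.prod_congr rfl this, Finset.prod_mul_distrib, Finset.prod_ite_eq' s v ψ, if_pos hv]
    rw [hsqrt, hsqrt, hstep y _ hy hz2, hstep x _ hx hz1, ← sub_mul, mul_pow, ← Finset.prod_pow,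
      mul_left_comm, ENNReal.ofReal_mul (sq_nonneg _)]
    refine mul_le_mul_right (le_of_eq ?_) _
    rw [ENNReal.ofReal_mul (hlam.nonneg _),
      ENNReal.ofReal_prod_of_nonneg fun _ _ => sq_nonneg _]
    have : ∀ z ∈ s, g z (eta z) = (if z = x then ENNReal.ofReal (lam (eta z)) else 1) *
        ENNReal.ofReal (b z (zeta z) ^ 2) := by
      intro z _
      rw [hbsq]
      by_cases h : z = x
      · subst h; simp [g, zeta, hk]
      · simp [g, zeta, h]
    rw [Finset.prod_congr rfl this, Finset.prod_mul_distrib,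
      Finset.prod_ite_eq' s x fun z => ENNReal.ofReal (lam (eta z)), if_pos hx]
  refine (lintegral_mono hpt).trans (le_of_eq ?_)
  rw [lintegral_const_mul' _ _ ENNReal.ofReal_ne_top, lintegral_infinitePi_prod,
    Finset.prod_eq_single_of_mem x hx, mul_comm]
  · simp only [g, if_true]
    rw [hbal fun k => ENNReal.ofReal (tilt σ (ψ x) k), lintegral_tilt hσ (h0 x) (h1 x), mul_one]
  · intro z _ hz
    simp only [g, if_neg hz]
    exact lintegral_tilt hσ (h0 z) (h1 z)

lemma dirichlet_profileDensity_le [IsProbabilityMeasure σ] (hσ : 0 < σ {0})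
    (h0 : ∀ z, 0 ≤ ψ z) (h1 : ∀ z, ψ z ≤ 1) (hB : ∀ z, z ∉ B → ψ z = 1) {lam : ℕ → ℝ}
    (hlam : IsJumpRate lam) {phi : ℝ}
    (hbal : ∀ g : ℕ → ℝ≥0∞, ∫⁻ k, ENNReal.ofReal (lam k) * g (k - 1) ∂σ
      = ENNReal.ofReal phi * ∫⁻ k, g k ∂σ) :
    dirichlet lam (Measure.infinitePi (fun _ : Site d => σ)) (profileDensity σ B ψ)
      ≤ ENNReal.ofReal phi * energy ψ := by
  rw [dirichlet, energy, ← ENNReal.tsum_mul_left]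
  exact ENNReal.tsum_le_tsum fun p =>
    bondDirichlet_profileDensity_le hσ h0 h1 hB hlam hbal p.2

end Profile

/-! ### Moments under the trial measures, and the penalised functional. -/

section Trial

variable {d : ℕ} {w : ℝ → ℝ} {rho K : ℝ} {ψ : Site d → ℝ} {μ : Measure (Config d)}

/-- Moment properties of a probability measure on configurations that is empty where `ψ = 0`, has
density `rho` where `ψ = 1`, and under which `w` has means at most `K`. -/
structure IsTrial (w : ℝ → ℝ) (rho K : ℝ) (ψ : Site d → ℝ) (μ : Measure (Config d)) : Prop where
  isProbabilityMeasure : IsProbabilityMeasure μ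
  integrable : ∀ z, Integrable (fun eta : Config d => (eta z : ℝ)) μ
  mean_eq_zero : ∀ z, ψ z = 0 → ∫ eta, (eta z : ℝ) ∂μ = 0
  mean_eq : ∀ z, ψ z = 1 → ∫ eta, (eta z : ℝ) ∂μ = rho
  integrable_weight : ∀ z, Integrable (fun eta : Config d => w (eta z : ℝ)) μ
  weight_le : ∀ z, ∫ eta, w (eta z : ℝ) ∂μ ≤ K

lemma lintegral_eval_withDensity (ν : Measure (Config d)) {f : Config d → ℝ} (hf : Measurable f)
    (z : Site d) (g : ℕ → ℝ≥0∞) :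
    ∫⁻ eta, g (eta z) ∂(ν.withDensity fun eta => ENNReal.ofReal (f eta))
      = ∫⁻ eta, ENNReal.ofReal (f eta) * g (eta z) ∂ν :=
  lintegral_withDensity_eq_lintegral_mul ν hf.ennreal_ofReal
    ((measurable_of_countable g).comp (measurable_pi_apply z))

/-- The bound on the means of `w` is free of `ψ`, because every tilted density is at most `(σ
{0})⁻¹`. -/
lemma isTrial_profileDensity {σ : Measure ℕ} [IsProbabilityMeasure σ] (hσ : 0 < σ {0})
    (hrho : 0 < rho) (hmean : ∫⁻ k, ENNReal.ofReal (k : ℝ) ∂σ = ENNReal.ofReal rho)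
    (hw0 : ∀ x, 0 ≤ x → 0 ≤ w x) (hw : ∫⁻ k, ENNReal.ofReal (w (k : ℝ)) ∂σ ≠ ∞)
    {B : Finset (Site d)} (h0 : ∀ z, 0 ≤ ψ z) (h1 : ∀ z, ψ z ≤ 1)
    (hB : ∀ z, z ∉ B → ψ z = 1) :
    IsTrial w rho ((σ {0})⁻¹ * ∫⁻ k, ENNReal.ofReal (w (k : ℝ)) ∂σ).toReal ψ
      ((Measure.infinitePi (fun _ : Site d => σ)).withDensity
        fun eta => ENNReal.ofReal (profileDensity σ B ψ eta)) := by
  set μ := (Measure.infinitePi (fun _ : Site d => σ)).withDensity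
    fun eta => ENNReal.ofReal (profileDensity σ B ψ eta)
  have heval : ∀ (z : Site d) (g : ℕ → ℝ≥0∞), ∫⁻ eta, g (eta z) ∂μ
      = ∫⁻ k, ENNReal.ofReal (tilt σ (ψ z) k) * g k ∂σ := fun z g => by
    rw [lintegral_eval_withDensity _ measurable_profileDensity,
      lintegral_profileDensity_mul hσ h0 h1 hB]
  have hle : ∀ (z : Site d) (g : ℕ → ℝ≥0∞), ∫⁻ eta, g (eta z) ∂μ
      ≤ (σ {0})⁻¹ * ∫⁻ k, g k ∂σ := fun z g => by
    rw [heval, ← lintegral_const_mul _ (measurable_of_countable g)]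
    exact lintegral_mono fun k => mul_le_mul_left (ofReal_tilt_le hσ (h0 z) (h1 z) k) _
  have hσ' : (σ {0})⁻¹ ≠ ∞ := ENNReal.inv_ne_top.2 hσ.ne'
  have hmeas : ∀ (z : Site d) (g : ℕ → ℝ),
      AEStronglyMeasurable (fun eta : Config d => g (eta z)) μ := fun z g =>
    ((measurable_of_countable g).comp (measurable_pi_apply z)).aestronglyMeasurable
  have hint : ∀ (z : Site d) (g : ℕ → ℝ), (∀ k, 0 ≤ g k) →
      ∫⁻ k, ENNReal.ofReal (g k) ∂σ ≠ ∞ → Integrable (fun eta : Config d => g (eta z)) μ := by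
    intro z g hg hfin
    refine ⟨hmeas z g, ?_⟩
    rw [hasFiniteIntegral_iff_ofReal (Eventually.of_forall fun eta => hg _)]
    exact (hle z fun k => ENNReal.ofReal (g k)).trans_lt (ENNReal.mul_lt_top hσ'.lt_top hfin.lt_top)
  have hval : ∀ (z : Site d) (g : ℕ → ℝ), (∀ k, 0 ≤ g k) → ∫ eta, g (eta z) ∂μ
      = (∫⁻ eta, ENNReal.ofReal (g (eta z)) ∂μ).toReal := fun z g hg =>
    integral_eq_lintegral_of_nonneg_ae (Eventually.of_forall fun eta => hg _) (hmeas z g)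
  have hwk : ∀ k : ℕ, 0 ≤ w (k : ℝ) := fun k => hw0 _ k.cast_nonneg
  refine ⟨⟨?_⟩, fun z => ?_, fun z hz => ?_, fun z hz => ?_, fun z => ?_, fun z => ?_⟩
  · have := heval 0 fun _ => 1
    simpa [lintegral_tilt hσ (h0 0) (h1 0)] using this
  · exact hint z (fun k => (k : ℝ)) (fun k => k.cast_nonneg)
      (hmean ▸ ENNReal.ofReal_ne_top)
  · rw [hval z (fun k => (k : ℝ)) (fun k => k.cast_nonneg),
      heval z fun k => ENNReal.ofReal (k : ℝ), hz]
    have : ∀ k : ℕ, ENNReal.ofReal (tilt σ 0 k) * ENNReal.ofReal (k : ℝ) = 0 := fun k => by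
      rcases eq_or_ne k 0 with rfl | hk
      · simp
      · simp [tilt_zero hk]
    simp only [this, lintegral_zero, ENNReal.toReal_zero]
  · rw [hval z (fun k => (k : ℝ)) (fun k => k.cast_nonneg),
      heval z fun k => ENNReal.ofReal (k : ℝ), hz]
    simp only [tilt_one, ENNReal.ofReal_one, one_mul]
    rw [hmean, ENNReal.toReal_ofReal hrho.le]
  · exact hint z (fun k => w (k : ℝ)) hwk hw
  · rw [hval z (fun k => w (k : ℝ)) hwk]
    exact ENNReal.toReal_mono (ENNReal.mul_ne_top hσ' hw)
      (hle z fun k => ENNReal.ofReal (w (k : ℝ)))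

lemma blockAvg_nonneg (n : ℕ) (eta : Config d) (x : Site d) : 0 ≤ blockAvg n eta x :=
  div_nonneg (Finset.sum_nonneg fun _ _ => Nat.cast_nonneg _) (by positivity)

/-- Jensen's inequality for the uniform weights on the box. -/
lemma weight_blockAvg_le (hconv : ConvexOn ℝ (Set.Ici 0) w) (n : ℕ) (eta : Config d)
    (x : Site d) :
    w (blockAvg n eta x) ≤ (∑ y ∈ box n x, w (eta y : ℝ)) / (2 * (n : ℝ) + 1) ^ d := by
  have h := hconv.map_sum_le (t := box n x) (w := fun _ => ((2 * (n : ℝ) + 1) ^ d)⁻¹)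
    (p := fun y => (eta y : ℝ)) (fun _ _ => by positivity) ?_ fun y _ => Set.mem_Ici.2 (Nat.cast_nonneg _)
  · simp only [smul_eq_mul, inv_mul_eq_div, ← Finset.sum_div] at h
    exact h
  · rw [Finset.sum_const, card_box, nsmul_eq_mul]
    push_cast
    exact mul_inv_cancel₀ (by positivity)

/-- No regularity of `g` is needed, since the block average is a function of the integer number of
particles in the box. -/
lemma measurable_comp_blockAvg (g : ℝ → ℝ) (n : ℕ) (x : Site d) :
    Measurable fun eta : Config d => g (blockAvg n eta x) := by
  have h : (fun eta : Config d => g (blockAvg n eta x))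
      = (fun k : ℕ => g ((k : ℝ) / (2 * (n : ℝ) + 1) ^ d)) ∘
        fun eta : Config d => ∑ y ∈ box n x, eta y := by
    ext eta
    simp [blockAvg]
  rw [h]
  exact (measurable_of_countable _).comp
    (Finset.measurable_fun_sum _ fun y _ => measurable_pi_apply y)

namespace IsTrial

lemma integrable_blockAvg (h : IsTrial w rho K ψ μ) (n : ℕ) (x : Site d) :
    Integrable (fun eta : Config d => blockAvg n eta x) μ :=
  (integrable_finsetSum _ fun y _ => h.integrable y).div_const _

lemma integral_blockAvg (h : IsTrial w rho K ψ μ) (n : ℕ) (x : Site d) :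
    ∫ eta, blockAvg n eta x ∂μ
      = (∑ y ∈ box n x, ∫ eta, (eta y : ℝ) ∂μ) / (2 * (n : ℝ) + 1) ^ d := by
  unfold blockAvg
  rw [integral_div, integral_finsetSum _ fun y _ => h.integrable y]

lemma integral_blockAvg_eq_zero (h : IsTrial w rho K ψ μ) {n : ℕ} {x : Site d} (hx : ∀ y ∈ box n x, ψ y = 0) :
    ∫ eta, blockAvg n eta x ∂μ = 0 := by
  rw [h.integral_blockAvg, Finset.sum_eq_zero fun y hy => h.mean_eq_zero y (hx y hy), zero_div]

lemma integral_blockAvg_eq (h : IsTrial w rho K ψ μ) {n : ℕ} {x : Site d} (hx : ∀ y ∈ box n x, ψ y = 1) :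
    ∫ eta, blockAvg n eta x ∂μ = rho := by
  rw [h.integral_blockAvg, Finset.sum_congr rfl fun y hy => h.mean_eq y (hx y hy),
    Finset.sum_const, card_box, nsmul_eq_mul]
  push_cast
  rw [mul_div_assoc, mul_div_cancel₀ _ (by positivity)]

lemma integrable_weight_blockAvg (h : IsTrial w rho K ψ μ)
    (hw0 : ∀ x, 0 ≤ x → 0 ≤ w x) (hconv : ConvexOn ℝ (Set.Ici 0) w) (n : ℕ) (x : Site d) :
    Integrable (fun eta : Config d => w (blockAvg n eta x)) μ := by
  refine ((integrable_finsetSum (box n x) fun y _ => h.integrable_weight y).div_const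
    ((2 * (n : ℝ) + 1) ^ d)).mono' (measurable_comp_blockAvg w n x).aestronglyMeasurable
    (Eventually.of_forall fun eta => ?_)
  rw [Real.norm_of_nonneg (hw0 _ (blockAvg_nonneg n eta x))]
  exact weight_blockAvg_le hconv n eta x

lemma integral_weight_blockAvg_le (h : IsTrial w rho K ψ μ)
    (hw0 : ∀ x, 0 ≤ x → 0 ≤ w x) (hconv : ConvexOn ℝ (Set.Ici 0) w) (n : ℕ) (x : Site d) :
    ∫ eta, w (blockAvg n eta x) ∂μ ≤ K := by
  refine (integral_mono (h.integrable_weight_blockAvg hw0 hconv n x)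
    ((integrable_finsetSum (box n x) fun y _ => h.integrable_weight y).div_const
    ((2 * (n : ℝ) + 1) ^ d)) fun eta => weight_blockAvg_le hconv n eta x).trans ?_
  rw [integral_div, integral_finsetSum _ fun y _ => h.integrable_weight y,
    div_le_iff₀ (by positivity)]
  refine (Finset.sum_le_sum fun y _ => h.weight_le y).trans_eq ?_
  rw [Finset.sum_const, card_box, nsmul_eq_mul]
  push_cast
  ring

lemma integral_abs_sub_blockAvg_ge (h : IsTrial w rho K ψ μ) (n n' : ℕ) (x y : Site d) :
    ∫ eta, blockAvg n eta x ∂μ - ∫ eta, blockAvg n' eta y ∂μ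
      ≤ ∫ eta, |blockAvg n eta x - blockAvg n' eta y| ∂μ := by
  have hi := (h.integrable_blockAvg n x).sub (h.integrable_blockAvg n' y)
  rw [← integral_sub (h.integrable_blockAvg n x) (h.integrable_blockAvg n' y)]
  exact integral_mono hi hi.abs fun eta => le_abs_self _

lemma integrable_observable (h : IsTrial w rho K ψ μ)
    (hw0 : ∀ x, 0 ≤ x → 0 ≤ w x) (hconv : ConvexOn ℝ (Set.Ici 0) w)
    (beta : ℝ) (n n' l l' : ℕ) (x y u v : Site d) :
    Integrable (fun eta : Config d => |blockAvg n eta x - blockAvg n' eta y|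
      - beta * (w (blockAvg l eta u) + w (blockAvg l' eta v))) μ :=
  ((h.integrable_blockAvg n x).sub (h.integrable_blockAvg n' y)).abs.sub
    (((h.integrable_weight_blockAvg hw0 hconv l u).add
      (h.integrable_weight_blockAvg hw0 hconv l' v)).const_mul beta)

lemma integral_observable_ge (h : IsTrial w rho K ψ μ)
    (hw0 : ∀ x, 0 ≤ x → 0 ≤ w x) (hconv : ConvexOn ℝ (Set.Ici 0) w)
    {beta : ℝ} (hbeta : 0 ≤ beta) (n n' l l' : ℕ) (x y u v : Site d) :
    ∫ eta, |blockAvg n eta x - blockAvg n' eta y| ∂μ - beta * (2 * K)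
      ≤ ∫ eta, (|blockAvg n eta x - blockAvg n' eta y|
      - beta * (w (blockAvg l eta u) + w (blockAvg l' eta v))) ∂μ := by
  have hu := h.integrable_weight_blockAvg hw0 hconv l u
  have hv := h.integrable_weight_blockAvg hw0 hconv l' v
  have hsub := integral_sub ((h.integrable_blockAvg n x).sub (h.integrable_blockAvg n' y)).abs
    ((hu.add hv).const_mul beta)
  simp only [Pi.sub_apply, Pi.add_apply] at hsub
  rw [hsub, integral_const_mul, integral_add hu hv]
  have h1 := h.integral_weight_blockAvg_le hw0 hconv l u
  have h2 := h.integral_weight_blockAvg_le hw0 hconv l' v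
  have h3 := mul_le_mul_of_nonneg_left (add_le_add h1 h2) hbeta
  linarith

end IsTrial

lemma expect_eq_integral {ν : Measure (Config d)} {f F : Config d → ℝ}
    (hF : Integrable F (ν.withDensity fun eta => ENNReal.ofReal (f eta))) :
    expect ν f F
      = ((∫ eta, F eta ∂(ν.withDensity fun eta => ENNReal.ofReal (f eta)) : ℝ) : EReal) := by
  have h1 := hF.lintegral_lt_top.ne
  have h2 := hF.neg.lintegral_lt_top.ne
  simp only [Pi.neg_apply] at h2
  rw [expect, integral_eq_lintegral_pos_part_sub_lintegral_neg_part hF, EReal.coe_sub,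
    EReal.coe_ennreal_toReal h1, EReal.coe_ennreal_toReal h2]

lemma le_penalised {lam : ℕ → ℝ} {ν : Measure (Config d)} {delta a b : ℝ} {N : ℕ}
    {F f : Config d → ℝ} (hb : 0 ≤ b)
    (hF : Integrable F (ν.withDensity fun eta => ENNReal.ofReal (f eta)))
    (hab : a + b ≤ ∫ eta, F eta ∂(ν.withDensity fun eta => ENNReal.ofReal (f eta)))
    (hcost : ENNReal.ofReal (delta * (N : ℝ) ^ ((2 : ℤ) - (d : ℤ))) * dirichlet lam ν f
      ≤ ENNReal.ofReal b) :
    (a : EReal) ≤ penalised lam ν delta N F f := by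
  rw [penalised, expect_eq_integral hF]
  have h1 : ((ENNReal.ofReal (delta * (N : ℝ) ^ ((2 : ℤ) - (d : ℤ))) * dirichlet lam ν f : ℝ≥0∞)
      : EReal) ≤ (b : EReal) := by
    refine (EReal.coe_ennreal_le_coe_ennreal_iff.2 hcost).trans_eq ?_
    rw [EReal.coe_ennreal_ofReal, max_eq_left hb]
  refine le_trans ?_ (EReal.sub_le_sub (EReal.coe_le_coe_iff.2 hab) h1)
  rw [← EReal.coe_sub, add_sub_cancel_right]

lemma cost_profileDensity_le {σ : Measure ℕ} [IsProbabilityMeasure σ] (hσ : 0 < σ {0})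
    {B : Finset (Site d)} (h0 : ∀ z, 0 ≤ ψ z) (h1 : ∀ z, ψ z ≤ 1)
    (hB : ∀ z, z ∉ B → ψ z = 1) {lam : ℕ → ℝ} (hlam : IsJumpRate lam) {phi : ℝ} (hphi : 0 ≤ phi)
    (hbal : ∀ g : ℕ → ℝ≥0∞, ∫⁻ k, ENNReal.ofReal (lam k) * g (k - 1) ∂σ
      = ENNReal.ofReal phi * ∫⁻ k, g k ∂σ) {delta κ : ℝ} (hdelta : 0 ≤ delta) {N : ℕ}
    (hκ : ENNReal.ofReal ((N : ℝ) ^ ((2 : ℤ) - (d : ℤ))) * energy ψ ≤ ENNReal.ofReal κ) :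
    ENNReal.ofReal (delta * (N : ℝ) ^ ((2 : ℤ) - (d : ℤ))) *
      dirichlet lam (Measure.infinitePi (fun _ : Site d => σ)) (profileDensity σ B ψ)
      ≤ ENNReal.ofReal (delta * phi * κ) := by
  rw [ENNReal.ofReal_mul hdelta, ENNReal.ofReal_mul (mul_nonneg hdelta hphi),
    ENNReal.ofReal_mul hdelta]
  calc _ ≤ ENNReal.ofReal delta * ENNReal.ofReal ((N : ℝ) ^ ((2 : ℤ) - (d : ℤ))) *
        (ENNReal.ofReal phi * energy ψ) := by
        gcongr
        exact dirichlet_profileDensity_le hσ h0 h1 hB hlam hbal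
    _ = ENNReal.ofReal delta * ENNReal.ofReal phi *
        (ENNReal.ofReal ((N : ℝ) ^ ((2 : ℤ) - (d : ℤ))) * energy ψ) := by ring
    _ ≤ _ := by gcongr

end Trial

/-! ### The averaged observable under a cutoff at scale `N ε / 4`. -/

section TwoBlock

variable {d : ℕ} {w : ℝ → ℝ} {rho K : ℝ} {μ : Measure (Config d)}

lemma le_tripleLimsup {Q : ℕ → ℝ → ℕ → EReal} {a : EReal}
    (h : ∀ l, ∀ᶠ eps in 𝓝[>] 0, ∀ᶠ N in atTop, a ≤ Q l eps N) : a ≤ tripleLimsup Q :=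
  le_limsup_of_frequently_le <| Eventually.frequently <| Eventually.of_forall fun l =>
    le_limsup_of_frequently_le <| Eventually.frequently <| (h l).mono fun _ heps =>
      le_limsup_of_frequently_le heps.frequently

/-- Outside the box of radius `2 m` the density is `rho`. For `d ≥ 2` and `M ≥ 4 m`, that box fills
at most half of the large one. -/
lemma half_le_integral_blockAvg_cutoff {M m : ℕ} (hd : 2 ≤ d) (hm : 1 ≤ m) (hmM : 4 * m ≤ M)
    (hrho : 0 < rho) (h : IsTrial w rho K (cutoff m) μ) :
    rho / 2 ≤ ∫ eta, blockAvg M eta 0 ∂μ := by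
  rw [h.integral_blockAvg, le_div_iff₀ (by positivity)]
  have hsub : box M 0 \ box (2 * m) 0 ⊆ box M (0 : Site d) := Finset.sdiff_subset
  have h1 : ((box M 0 \ box (2 * m) (0 : Site d)).card : ℝ) * rho
      ≤ ∑ y ∈ box M (0 : Site d), ∫ eta, (eta y : ℝ) ∂μ := by
    refine le_trans (le_of_eq ?_) (Finset.sum_le_sum_of_subset_of_nonneg hsub fun y _ _ =>
      integral_nonneg fun eta => Nat.cast_nonneg _)
    rw [Finset.sum_congr rfl fun y hy => h.mean_eq y (cutoff_eq_one hm ?_), Finset.sum_const,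
      nsmul_eq_mul]
    have hy2 := (Finset.mem_sdiff.1 hy).2
    rw [mem_box, sub_zero, not_le] at hy2
    push_cast at hy2
    exact hy2.le
  have h2 : (2 * M + 1) ^ d
      ≤ (box M 0 \ box (2 * m) (0 : Site d)).card + (2 * (2 * m) + 1) ^ d := by
    rw [← card_box M (0 : Site d), ← card_box (2 * m) (0 : Site d)]
    exact Nat.sub_le_iff_le_add.1 (Finset.le_card_sdiff _ _)
  have h3 : 2 * (2 * (2 * m) + 1) ^ d ≤ (2 * M + 1) ^ d := by
    obtain ⟨k, rfl⟩ := Nat.exists_eq_add_of_le' hd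
    calc 2 * (2 * (2 * m) + 1) ^ (k + 2)
        = (2 * (2 * m) + 1) ^ k * (2 * (2 * (2 * m) + 1) ^ 2) := by ring
      _ ≤ (2 * M + 1) ^ k * (2 * M + 1) ^ 2 := by
          refine Nat.mul_le_mul (Nat.pow_le_pow_left (by omega) k) ?_
          nlinarith
      _ = _ := by ring
  have h4 : (2 * (M : ℝ) + 1) ^ d ≤ 2 * (box M 0 \ box (2 * m) (0 : Site d)).card := by
    have : (2 * M + 1) ^ d ≤ 2 * (box M 0 \ box (2 * m) (0 : Site d)).card := by omega
    exact_mod_cast this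
  nlinarith

/-- Bounds below the number of centres `y` whose `l`-block lies in the empty region. Here `2 M + 3`
exceeds `2 ε N + 1` when `M` is the integer part of `N ε`, and `11 l + 5` is large enough for `2 M +
3 ≤ 16 (2 m - 4 l)`. -/
lemma pow_le_card_annulus {M m l : ℕ} (hd : d ≠ 0) (hm : m = M / 4) (hM : 11 * l + 5 ≤ M) :
    (2 * M + 3) ^ d ≤ 16 ^ d * (box (m - l) 0 \ box l (0 : Site d)).card := by
  have h1 : (2 * (m - l) + 1) ^ d
      ≤ (box (m - l) 0 \ box l (0 : Site d)).card + (2 * l + 1) ^ d := by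
    rw [← card_box (m - l) (0 : Site d), ← card_box l (0 : Site d)]
    exact Nat.sub_le_iff_le_add.1 (Finset.le_card_sdiff _ _)
  -- Superadditivity of the `d`-th power, from `2 (m - l) + 1 = (2 m - 4 l) + (2 l + 1)`.
  have h2 : (2 * m - 4 * l) ^ d + (2 * l + 1) ^ d ≤ (2 * (m - l) + 1) ^ d := by
    refine (pow_add_pow_le (Nat.zero_le _) (Nat.zero_le _) hd).trans_eq ?_
    congr 1
    omega
  have h3 : (2 * M + 3) ^ d ≤ 16 ^ d * (2 * m - 4 * l) ^ d := by
    rw [← mul_pow]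
    exact Nat.pow_le_pow_left (by omega) d
  exact h3.trans (Nat.mul_le_mul_left _ (by omega))

lemma integrable_avgObservable {ψ : Site d → ℝ} (h : IsTrial w rho K ψ μ)
    (hw0 : ∀ x, 0 ≤ x → 0 ≤ w x) (hconv : ConvexOn ℝ (Set.Ici 0) w) (beta : ℝ) (l : ℕ) (eps : ℝ)
    (N : ℕ) (x : Site d) : Integrable (avgObservable w beta l eps N x) μ :=
  (integrable_finsetSum _ fun _ _ =>
    h.integrable_observable hw0 hconv beta _ _ _ _ _ _ _ _).const_mul _

lemma le_integral_avgObservable_cutoff (hd : 2 ≤ d) (hrho : 0 < rho) (hK : 0 ≤ K)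
    (hw0 : ∀ x, 0 ≤ x → 0 ≤ w x) (hconv : ConvexOn ℝ (Set.Ici 0) w) {beta : ℝ} (hbeta : 0 ≤ beta)
    {l N : ℕ} {eps : ℝ} (heps : 0 < eps) {M m : ℕ} (hMe : M = ⌊(N : ℝ) * eps⌋₊)
    (hm : m = M / 4) (hM : 11 * l + 5 ≤ M) (h : IsTrial w rho K (cutoff m) μ) :
    (1 / 16) ^ d * rho / 2 - beta * (2 * K) ≤ ∫ eta, avgObservable w beta l eps N 0 eta ∂μ := by
  have hNe : 0 ≤ (N : ℝ) * eps := by positivity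
  set D : ℝ := (2 * eps * (N : ℝ) + 1) ^ d with hD
  have hD0 : 0 < D := by positivity
  set S : Finset (Site d) := box M 0 \ box l 0 with hS
  set S₀ : Finset (Site d) := box (m - l) 0 \ box l 0 with hS₀
  have hSS : S₀ ⊆ S := by
    refine Finset.sdiff_subset_sdiff (fun y hy => ?_) (Finset.Subset.refl _)
    rw [mem_box] at hy ⊢
    exact hy.trans (by exact_mod_cast (by omega : m - l ≤ M))
  have hScard : (S.card : ℝ) ≤ D := by
    have h1 : S.card ≤ (2 * M + 1) ^ d :=
      (Finset.card_le_card Finset.sdiff_subset).trans_eq (card_box M 0)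
    have h2 : (M : ℝ) ≤ N * eps := hMe ▸ Nat.floor_le hNe
    calc (S.card : ℝ) ≤ (2 * (M : ℝ) + 1) ^ d := by exact_mod_cast h1
      _ ≤ D := pow_le_pow_left₀ (by positivity) (by linarith) d
  have hS₀card : (1 / 16) ^ d * D ≤ S₀.card := by
    have h1 : (N : ℝ) * eps < M + 1 := hMe ▸ Nat.lt_floor_add_one _
    have h2 : ((2 * M + 3 : ℕ) : ℝ) ^ d ≤ 16 ^ d * (S₀.card : ℝ) := by
      exact_mod_cast pow_le_card_annulus (by omega : d ≠ 0) hm hM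
    have h3 : D ≤ ((2 * M + 3 : ℕ) : ℝ) ^ d := by
      refine pow_le_pow_left₀ (by positivity) ?_ d
      push_cast
      linarith
    rw [one_div, inv_pow, inv_mul_le_iff₀ (by positivity)]
    exact h3.trans h2
  have hM4 : 4 * m ≤ M := by omega
  have hhalf := half_le_integral_blockAvg_cutoff hd (by omega) hM4 hrho h
  let A : Site d → ℝ := fun y => ∫ eta, |blockAvg M eta 0 - blockAvg l eta (0 + y)| ∂μ
  have hA0 : ∀ y, 0 ≤ A y := fun y => integral_nonneg fun _ => abs_nonneg _
  -- For these `y` the small block lies within radius `m`, hence is empty, while the large block has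
  -- mean at least `rho / 2`.
  have hA : ∀ y ∈ S₀, rho / 2 ≤ A y := by
    intro y hy
    have hy1 := (Finset.mem_sdiff.1 hy).1
    rw [mem_box, sub_zero, Nat.cast_sub (by omega)] at hy1
    have hzero : ∫ eta, blockAvg l eta (0 + y) ∂μ = 0 := by
      refine h.integral_blockAvg_eq_zero fun z hz => cutoff_eq_zero ?_
      rw [mem_box, zero_add] at hz
      linarith [norm_sub_norm_le z y]
    have := h.integral_abs_sub_blockAvg_ge M l 0 (0 + y)
    rw [hzero, sub_zero] at this
    exact hhalf.trans this
  have hint : ∫ eta, avgObservable w beta l eps N 0 eta ∂μ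
      = 1 / D * ∑ y ∈ S, ∫ eta, (|blockAvg M eta 0 - blockAvg l eta (0 + y)|
        - beta * (w (blockAvg l eta 0) + w (blockAvg l eta (0 + y)))) ∂μ := by
    unfold avgObservable
    rw [← hMe, integral_const_mul, integral_finsetSum _ fun _ _ =>
      h.integrable_observable hw0 hconv beta _ _ _ _ _ _ _ _]
  have hsum : S₀.card * (rho / 2) - D * (beta * (2 * K))
      ≤ ∑ y ∈ S, ∫ eta, (|blockAvg M eta 0 - blockAvg l eta (0 + y)|
        - beta * (w (blockAvg l eta 0) + w (blockAvg l eta (0 + y)))) ∂μ := by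
    have h1 : S₀.card * (rho / 2) ≤ ∑ y ∈ S, A y := by
      refine le_trans ?_ (Finset.sum_le_sum_of_subset_of_nonneg hSS fun y _ _ => hA0 y)
      rw [← nsmul_eq_mul]
      exact Finset.card_nsmul_le_sum _ _ _ hA
    have h2 : (S.card : ℝ) * (beta * (2 * K)) ≤ D * (beta * (2 * K)) :=
      mul_le_mul_of_nonneg_right hScard (by positivity)
    have h3 : ∑ y ∈ S, (A y - beta * (2 * K)) ≤ _ := Finset.sum_le_sum fun y _ =>
      h.integral_observable_ge hw0 hconv hbeta M l l l 0 (0 + y) 0 (0 + y)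
    rw [Finset.sum_sub_distrib, Finset.sum_const, nsmul_eq_mul] at h3
    linarith
  rw [hint, one_div_mul_eq_div, le_div_iff₀ hD0]
  nlinarith

end TwoBlock

/-! ### Trial densities for the equilibrium measure, and the conclusion. -/

section Main

variable {d : ℕ} {lam : ℕ → ℝ} {w : ℝ → ℝ} {rho : ℝ}

/-- Product densities with a given profile, their moments, and their cost. -/
lemma exists_trial (hlam : IsJumpRate lam) (hw : IsSuperlinearWeight lam d w) (hrho : 0 < rho) :
    ∃ K C : ℝ, 0 ≤ K ∧ 0 ≤ C ∧ ∀ (ψ : Site d → ℝ) (R : ℕ), (∀ z, 0 ≤ ψ z) → (∀ z, ψ z ≤ 1) →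
      (∀ z, (R : ℝ) ≤ ‖z‖ → ψ z = 1) → ∃ f ∈ densities (equilibrium lam d rho),
        IsTrial w rho K ψ
          ((equilibrium lam d rho).withDensity fun eta => ENNReal.ofReal (f eta)) ∧
        ∀ (delta κ : ℝ) (N : ℕ), 0 ≤ delta →
          ENNReal.ofReal ((N : ℝ) ^ ((2 : ℤ) - (d : ℤ))) * energy ψ ≤ ENNReal.ofReal κ →
          ENNReal.ofReal (delta * (N : ℝ) ^ ((2 : ℤ) - (d : ℤ))) *
            dirichlet lam (equilibrium lam d rho) f ≤ ENNReal.ofReal (delta * C * κ) := by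
  have hphi := hlam.fugacity_nonneg hrho
  have := hlam.isProbabilityMeasure hphi
  have hσ := hlam.siteMeasure_zero_pos hphi
  refine ⟨((siteMeasure lam (fugacity lam rho) {0})⁻¹ *
    ∫⁻ k, ENNReal.ofReal (w (k : ℝ)) ∂siteMeasure lam (fugacity lam rho)).toReal,
    fugacity lam rho, ENNReal.toReal_nonneg, hphi, fun ψ R h0 h1 hR => ?_⟩
  have hB : ∀ z, z ∉ box R 0 → ψ z = 1 := fun z hz => by
    rw [mem_box, sub_zero, not_le] at hz
    exact hR z hz.le
  exact ⟨profileDensity _ (box R 0) ψ, profileDensity_mem_densities hσ h0 h1 hB,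
    isTrial_profileDensity hσ hrho (hlam.lintegral_cast hrho) hw.nonneg
      (hw.lintegral_ne_top hlam hrho) h0 h1 hB,
    fun delta κ N hdelta hκ => cost_profileDensity_le hσ h0 h1 hB hlam hphi
      (hlam.lintegral_rate_mul hphi) hdelta hκ⟩

end Main

end ZeroRange

end

open ZeroRange in
theorem mainTheorem7 (d : ℕ) (hd : 2 ≤ d) (lam : ℕ → ℝ) (hlam : ZeroRange.IsJumpRate lam)
    (w : ℝ → ℝ) (hw : ZeroRange.IsSuperlinearWeight lam d w) (rho : ℝ) (hrho : 0 < rho) :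
    ∃ beta₀ : ℝ, 0 < beta₀ ∧ ∀ beta : ℝ, 0 < beta → beta ≤ beta₀ → ∀ delta : ℝ, 0 < delta →
      0 < ZeroRange.tripleLimsup (ZeroRange.twoBlock lam w d rho beta delta) ∧
      (3 ≤ d → 0 < ZeroRange.tripleLimsup (ZeroRange.avgTwoBlock lam w d rho beta delta)) := by
  obtain ⟨K, C, hK, hC, htrial⟩ := exists_trial hlam hw hrho
  set c : ℝ := (1 / 16) ^ d * rho with hc
  have hc0 : 0 < c := by positivity
  have hcrho : c ≤ rho :=
    mul_le_of_le_one_left hrho.le (pow_le_one₀ (by norm_num) (by norm_num))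
  -- The gain is at least `c / 2` in both estimates. The `w` terms take at most `c / 4` and the
  -- Dirichlet cost at most `c / 8`, which leaves `c / 8`.
  refine ⟨c / (8 * (K + 1)), by positivity, fun beta hbeta hbeta₀ delta hdelta => ?_⟩
  have hbK : beta * (2 * K) ≤ c / 4 := by
    rw [le_div_iff₀ (by positivity)] at hbeta₀
    nlinarith
  set κ : ℝ := c / (8 * (delta * C + 1)) with hκ
  have hdC : 0 ≤ delta * C := by positivity
  have hκ0 : 0 < κ := by positivity
  have hcost : delta * C * κ ≤ c / 8 := by
    have : κ * (8 * (delta * C + 1)) = c := div_mul_cancel₀ _ (by positivity)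
    nlinarith
  have hpos : (0 : EReal) < ((c / 8 : ℝ) : EReal) := by
    rw [EReal.coe_pos]
    positivity
  refine ⟨hpos.trans_le (le_tripleLimsup fun l => ?_),
    fun hd3 => hpos.trans_le (le_tripleLimsup fun l => ?_)⟩
  · obtain ⟨ψ, R, h0, h1, hzero, hone, hen⟩ := exists_profile hd l hκ0
    obtain ⟨f, hf, hT, hDir⟩ := htrial ψ R h0 h1 hone
    have : Nonempty (Fin d) := ⟨⟨0, by omega⟩⟩
    -- The block about `x` lies where `ψ = 1`. The distance `R + l` is independent of `N`, hence at
    -- most `N ε` for large `N`.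
    let x : Site d := fun _ => ((R + l : ℕ) : ℤ)
    have hx : ‖x‖ = (R : ℝ) + l := by
      rw [pi_norm_const, Int.norm_natCast]
      push_cast
      rfl
    filter_upwards [self_mem_nhdsWithin] with eps heps
    have heps : 0 < eps := heps
    filter_upwards [hen, eventually_ge_atTop ⌈((R : ℝ) + l) / eps⌉₊] with N hN hNx
    have hdist : ‖x - 0‖ ≤ (N : ℝ) * eps := by
      rw [sub_zero, hx, ← div_le_iff₀ heps]
      exact Nat.ceil_le.1 hNx
    refine le_iSup_of_le x <| le_iSup_of_le 0 <| le_iSup_of_le hdist <| le_iSup₂_of_le f hf <|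
      le_penalised (by positivity : 0 ≤ c / 8)
        (hT.integrable_observable hw.nonneg hw.convex beta l l l l x 0 x 0) ?_
        ((hDir delta κ N hdelta.le hN).trans (ENNReal.ofReal_le_ofReal hcost))
    have hi := hT.integral_observable_ge hw.nonneg hw.convex hbeta.le l l l l x 0 x 0
    have hs := hT.integral_abs_sub_blockAvg_ge l l x 0
    rw [hT.integral_blockAvg_eq fun y hy => hone y ?_,
      hT.integral_blockAvg_eq_zero fun y hy => hzero y ?_] at hs
    · unfold pairObservable
      linarith
    · rwa [mem_box, sub_zero] at hy
    · rw [mem_box] at hy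
      have := norm_sub_norm_le x y
      rw [norm_sub_rev] at this
      linarith
  -- Here `delta` is absorbed by taking `ε` small: the scaled energy is at most `63 ^ d * eps`.
  · have hsmall : ∀ᶠ eps : ℝ in 𝓝[>] 0, eps < min 1 (κ / 63 ^ d) :=
      mem_nhdsWithin_of_mem_nhds (Iio_mem_nhds (by positivity))
    filter_upwards [self_mem_nhdsWithin, hsmall] with eps heps hlt
    have heps : 0 < eps := heps
    obtain ⟨heps1, hepsκ⟩ := lt_min_iff.1 hlt
    filter_upwards [eventually_ge_atTop ⌈((11 * l + 5 : ℕ) : ℝ) / eps⌉₊] with N hN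
    have hNe : ((11 * l + 5 : ℕ) : ℝ) ≤ (N : ℝ) * eps := by
      rw [← div_le_iff₀ heps]
      exact Nat.ceil_le.1 hN
    obtain ⟨M, hM⟩ : ∃ M, M = ⌊(N : ℝ) * eps⌋₊ := ⟨_, rfl⟩
    obtain ⟨m, hm⟩ : ∃ m, m = M / 4 := ⟨_, rfl⟩
    have hMl : 11 * l + 5 ≤ M := hM ▸ Nat.le_floor hNe
    have hm1 : 1 ≤ m := by omega
    have hmN : (m : ℝ) ≤ N * eps := by
      have h1 : (M : ℝ) ≤ N * eps := hM ▸ Nat.floor_le (by positivity)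
      have h2 : (m : ℝ) ≤ M := by exact_mod_cast (by omega : m ≤ M)
      linarith
    obtain ⟨f, hf, hT, hDir⟩ := htrial (cutoff m) (2 * m) (cutoff_nonneg m) (cutoff_le_one m)
      fun z hz => cutoff_eq_one hm1 (by exact_mod_cast hz)
    have hen := (energy_cutoff_scaled_le hd3 hm1 heps1.le hmN).trans
      (ENNReal.ofReal_le_ofReal (by rw [lt_div_iff₀ (by positivity)] at hepsκ; linarith :
        63 ^ d * eps ≤ κ))
    refine le_iSup_of_le 0 <| le_iSup₂_of_le f hf <|
      le_penalised (by positivity : 0 ≤ c / 8)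
        (integrable_avgObservable hT hw.nonneg hw.convex beta l eps N 0) ?_
        ((hDir delta κ N hdelta.le hen).trans (ENNReal.ofReal_le_ofReal hcost))
    have hi := le_integral_avgObservable_cutoff hd hrho hK hw.nonneg hw.convex hbeta.le heps hM hm
      hMl hT
    linarith
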